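/- Let $H\in(0,1)$, $\theta>0$, and let $q\ge 2$ be an even integer. Let $B^H=\{B^H_t,\ t\ge 0\}$ be a fractional Brownian motion with Hurst index $H$ (a centred Gaussian process with almost surely continuous paths and $E[B^H_sB^H_t]=\frac12(s^{2H}+t^{2H}-|t-s|^{2H})$), and let $X$ be the fractional Ornstein–Uhlenbeck process, i.e. the process with almost surely continuous paths solving $$X_0=0,\qquad X_t=-\theta\int_0^t X_s\,ds+B^H_t,\quad t\ge 0 .$$ Let $H_q$ be the $q$-th (probabilists') Hermite polynomial and put $$Q_{q,n}(X)=\frac1n\sum_{k=0}^{n-1}H_q(X_k),\qquad \mu_q(\vartheta)=\frac{q!}{(q/2)!\,2^{q/2}}\left(H\Gamma(2H)\vartheta^{-2H}-1\right)^{q/2},\quad \vartheta>0 .$$ If $q/2$ is odd, then $\mu_q$ is injective on $(0,\infty)$; if $q/2$ is even, then $\mu_q$ is injective on $(0,\theta^*)$ and on $(\theta^*,\infty)$, where $\theta^*=(H\Gamma(2H))^{1/(2H)}$. Moreover, let $I\subseteq(0,\infty)$ be any open set containing $\theta$ on which $\mu_q$ is injective (so $I=(0,\infty)$ is allowed when $q/2$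 is odd), let $\mu_q^{-1}:\mu_q(I)\to I$ be the inverse of $\mu_q|_I$, and let $$\widehat\theta_{q,n}=\mu_q^{-1}\left(Q_{q,n}(X)\right)$$ (with an arbitrary value if $Q_{q,n}(X)\notin\mu_q(I)$). Then, almost surely, $Q_{q,n}(X)\in\mu_q(I)$ for all sufficiently large $n$, and $$\widehat\theta_{q,n}\longrightarrow\theta\qquad\text{as } n\to\infty .$$ -/

import Mathlib

open MeasureTheory ProbabilityTheory Filter Topology
open scoped NNReal

/-- `B` is a fractional Brownian motion of Hurst index `H` under `P`: a centred Gaussian process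
indexed by `[0, ∞)` with covariance `(s ^ (2H) + t ^ (2H) - |t - s| ^ (2H)) / 2` and almost surely
continuous paths. -/
structure IsFractionalBrownianMotion {Ω : Type*} [MeasurableSpace Ω] (H : ℝ)
    (B : ℝ≥0 → Ω → ℝ) (P : Measure Ω) : Prop where
  isGaussianProcess : IsGaussianProcess B P
  centered : ∀ t, ∫ ω, B t ω ∂P = 0
  covariance_eq : ∀ s t, cov[B s, B t; P] =
    ((s : ℝ) ^ (2 * H) + (t : ℝ) ^ (2 * H) - |(t : ℝ) - s| ^ (2 * H)) / 2
  continuous_paths : ∀ᵐ ω ∂P, Continuous fun t ↦ B t ω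

/-- `X` solves the equation `X₀ = 0`, `dX_t = -θ X_t dt + dB_t`, `t ≥ 0`: almost every path of `X`
is continuous, starts at `0` and satisfies the corresponding integral equation. -/
def IsOrnsteinUhlenbeckDrivenBy {Ω : Type*} [MeasurableSpace Ω] (θ : ℝ)
    (X B : ℝ≥0 → Ω → ℝ) (P : Measure Ω) : Prop :=
  ∀ᵐ ω ∂P, X 0 ω = 0 ∧ (Continuous fun t ↦ X t ω) ∧
    ∀ t : ℝ≥0, X t ω = -θ * (∫ s in (0 : ℝ)..t, X s.toNNReal ω) + B t ω

/-- The Hermite variation `Q_{q,n}(x) = (1/n) ∑_{k=0}^{n-1} H_q(x_k)` of a real sequence, where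
`H_q` is the probabilists' Hermite polynomial. -/
noncomputable def hermiteVariation (q n : ℕ) (x : ℕ → ℝ) : ℝ :=
  (1 / (n : ℝ)) * ∑ k ∈ Finset.range n, Polynomial.aeval (x k) (Polynomial.hermite q)

/-- The function
`μ_q(ϑ) = q! / ((q/2)! 2 ^ (q/2)) * (H Γ(2H) ϑ ^ (-2H) - 1) ^ (q/2)`, for even `q`. -/
noncomputable def muFun (H : ℝ) (q : ℕ) (ϑ : ℝ) : ℝ :=
  ((q.factorial : ℝ) / (((q / 2).factorial : ℝ) * 2 ^ (q / 2))) *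
    (H * Real.Gamma (2 * H) * ϑ ^ (-2 * H) - 1) ^ (q / 2)

/-- The estimator `μ_q⁻¹(Q_{q,n}(X))` computed from the observations `x_k = X_k`, where `μ_q⁻¹` is
the inverse of `μ_q` on the parameter set `I` (an arbitrary value is returned if `Q_{q,n}(X)` is
not in `μ_q(I)`). -/
noncomputable def hermiteEstimator (H : ℝ) (q : ℕ) (I : Set ℝ) (n : ℕ) (x : ℕ → ℝ) : ℝ :=
  Function.invFunOn (muFun H q) I (hermiteVariation q n x)

/-!
The averaged Hermite polynomial `Q_{q,n}(X)` converges almost surely to `μ_q(θ)`, and `μ_q` has a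
continuous inverse near `θ`; both claims about the estimator follow.

*Gaussian structure.* Variation of constants writes the solution pathwise as the average
`X_t = ∫ (B_t - B_{t - r}) dν(r)` over an exponential lag `r ~ ν = Exp(θ)`, truncated at `t`
(`eq_integral_increment_expMeasure`). An integral of a Gaussian process with continuous paths is an
almost sure limit of integrals along simple functions, so `X` is jointly Gaussian and its covariance
is the average of increment covariances over two independent lags (`map_integral_gaussianProcess`,
`gaussian_pair_ou`).

*Covariances.* An increment covariance at distance `d` is a second difference of `|z| ^ (2H)`, hence
`Cov(X_s, X_t) = O(|t - s| ^ (2H - 2))` (`abs_ouCov_le`). By dominated convergence `Var X_t` tends to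
`(E τ ^ (2H) + E τ' ^ (2H) - E |τ - τ'| ^ (2H)) / 2` with `τ, τ'` independent exponential variables.
As `|τ - τ'|` is again exponential, this is `E τ ^ (2H) / 2 = H Γ(2H) θ ^ (-2H)`
(`tendsto_ouCov_self`).

*Polynomials of Gaussian variables.* Stein's identity gives the recursion
`E[H_{n+2}(U)] = (n + 1) (Var U - 1) E[H_n(U)]`, whence `E[H_q(X_k)] → μ_q(θ)`, and the bound
`|Cov(p(U), g(V))| ≤ C |Cov(U, V)|` for Gaussian pairs with bounded variances
(`exists_abs_covariance_polynomial_le`).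

*Law of large numbers.* For even `q` the polynomial `H_q` is bounded below, so up to a linear term
the sums `∑ H_q(X_k)` are monotone. Chebyshev's inequality along geometric subsequences then yields
almost sure convergence of the averages (`ae_tendsto_sum_div_of_covariance_le`).
-/

/-! ### Polynomials of Gaussian random variables -/

section GaussianPolynomials

open Polynomial

variable {Ω : Type*} [MeasurableSpace Ω] {P : Measure Ω} {U V : Ω → ℝ}

lemma ProbabilityTheory.HasGaussianLaw.integrable_polynomial_eval (hU : HasGaussianLaw U P)
    (p : ℝ[X]) : Integrable (fun ω ↦ p.eval (U ω)) P := by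
  have := hU.isProbabilityMeasure
  induction p using Polynomial.induction_on' with
  | add p q hp hq => exact (hp.add hq).congr (ae_of_all _ fun ω ↦ by simp)
  | monomial n a =>
    simp only [eval_monomial]
    refine Integrable.const_mul ?_ a
    have h : MemLp U (n : ENNReal) P := hU.memLp (ENNReal.natCast_ne_top n)
    have := h.integrable_norm_pow'
    refine this.mono' ((hU.aemeasurable.pow_const n).aestronglyMeasurable) ?_
    exact ae_of_all _ fun ω ↦ by simp

lemma ProbabilityTheory.HasGaussianLaw.memLp_two_polynomial_eval (hU : HasGaussianLaw U P)
    (p : ℝ[X]) : MemLp (fun ω ↦ p.eval (U ω)) 2 P := by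
  refine (memLp_two_iff_integrable_sq ?_).2 ?_
  · exact (hU.integrable_polynomial_eval p).aestronglyMeasurable
  · exact (hU.integrable_polynomial_eval (p ^ 2)).congr (ae_of_all _ fun ω ↦ by simp)

lemma integrable_polynomial_eval_mul (hU : HasGaussianLaw U P) (hV : HasGaussianLaw V P)
    (p g : ℝ[X]) : Integrable (fun ω ↦ p.eval (U ω) * g.eval (V ω)) P :=
  (hU.memLp_two_polynomial_eval p).integrable_mul (hV.memLp_two_polynomial_eval g)

lemma integrable_polynomial_eval_gaussianReal (v : ℝ≥0) (p : ℝ[X]) :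
    Integrable (fun x ↦ p.eval x) (gaussianReal 0 v) :=
  (IsGaussian.hasGaussianLaw_id (μ := gaussianReal 0 v)).integrable_polynomial_eval p

lemma hasDerivAt_gaussianPDFReal_zero {v : ℝ≥0} (hv : v ≠ 0) (x : ℝ) :
    HasDerivAt (gaussianPDFReal 0 v) (-(x / v) * gaussianPDFReal 0 v x) x := by
  have hv' : (v : ℝ) ≠ 0 := by exact_mod_cast hv
  unfold gaussianPDFReal
  have h : HasDerivAt (fun y : ℝ ↦ -(y - 0) ^ 2 / (2 * (v : ℝ))) (-(x / v)) x := by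
    have := ((((hasDerivAt_id x).sub_const 0).pow 2).neg).div_const (2 * (v : ℝ))
    refine this.congr_deriv ?_
    simp only [id_eq]
    field_simp
    simp [mul_comm]
  refine (h.exp.const_mul (√(2 * Real.pi * v))⁻¹).congr_deriv ?_
  ring

lemma integrable_mul_gaussianPDFReal {v : ℝ≥0} (hv : v ≠ 0) (p : ℝ[X]) :
    Integrable (fun x ↦ p.eval x * gaussianPDFReal 0 v x) := by
  have h := integrable_polynomial_eval_gaussianReal v p
  rw [gaussianReal_of_var_ne_zero _ hv, integrable_withDensity_iff (measurable_gaussianPDF 0 v)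
    (ae_of_all _ fun x ↦ gaussianPDF_lt_top)] at h
  simpa only [toReal_gaussianPDF] using h

/-- Stein's identity for polynomials under a centred Gaussian law on `ℝ`. -/
lemma integral_id_mul_polynomial_gaussianReal (v : ℝ≥0) (p : ℝ[X]) :
    ∫ x, x * p.eval x ∂gaussianReal 0 v = v * ∫ x, (derivative p).eval x ∂gaussianReal 0 v := by
  by_cases hv : v = 0
  · subst hv; simp [gaussianReal_zero_var]
  have hv' : (v : ℝ) ≠ 0 := by exact_mod_cast hv
  have key := integral_mul_deriv_eq_deriv_mul_of_integrable (u := fun x ↦ p.eval x)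
    (v := gaussianPDFReal 0 v) (u' := fun x ↦ (derivative p).eval x)
    (v' := fun x ↦ -(x / v) * gaussianPDFReal 0 v x)
    (fun x _ ↦ p.hasDerivAt x) (fun x _ ↦ hasDerivAt_gaussianPDFReal_zero hv x)
    (by
      have := (integrable_mul_gaussianPDFReal hv (X * p)).const_mul (-(1 / (v : ℝ)))
      refine this.congr (ae_of_all _ fun x ↦ ?_)
      simp only [eval_mul, eval_X, Pi.mul_apply]; ring)
    (integrable_mul_gaussianPDFReal hv _) (integrable_mul_gaussianPDFReal hv _)
  rw [integral_gaussianReal_eq_integral_smul hv, integral_gaussianReal_eq_integral_smul hv]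
  simp only [smul_eq_mul]
  have e1 : ∫ x, gaussianPDFReal 0 v x * (derivative p).eval x
      = ∫ x, (derivative p).eval x * gaussianPDFReal 0 v x :=
    integral_congr_ae (ae_of_all _ fun x ↦ mul_comm _ _)
  have e2 : ∫ x, gaussianPDFReal 0 v x * (x * p.eval x)
      = -(v : ℝ) * ∫ x, p.eval x * (-(x / v) * gaussianPDFReal 0 v x) := by
    rw [← integral_const_mul]
    refine integral_congr_ae (ae_of_all _ fun x ↦ ?_)
    simp only
    field_simp
  rw [e1, e2, key]; ring

/-- Stein's identity for a Gaussian pair: `E[U p(U) g(V)] = Var U E[p'(U) g(V)] +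
Cov(U, V) E[p(U) g'(V)]`. -/
lemma integral_mul_polynomial_of_gaussian_pair
    (hUV : HasGaussianLaw (fun ω ↦ (U ω, V ω)) P) (hU0 : ∫ ω, U ω ∂P = 0) (p g : ℝ[X]) :
    ∫ ω, U ω * p.eval (U ω) * g.eval (V ω) ∂P
      = Var[U; P] * ∫ ω, (derivative p).eval (U ω) * g.eval (V ω) ∂P
        + cov[U, V; P] * ∫ ω, p.eval (U ω) * (derivative g).eval (V ω) ∂P := by
  have := hUV.isProbabilityMeasure
  have hU : HasGaussianLaw U P := hUV.fst
  have hV : HasGaussianLaw V P := hUV.snd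
  have mU := hU.aemeasurable
  have mV := hV.aemeasurable
  set u := Var[U; P] with hu
  set ρ := cov[U, V; P] with hρ
  have i1 : Integrable (fun ω ↦ U ω * p.eval (U ω) * g.eval (V ω)) P := 
    (integrable_polynomial_eval_mul hU hV (X * p) g).congr (ae_of_all _ fun ω ↦ by simp)
  have i2 := integrable_polynomial_eval_mul hU hV (derivative p) g
  have i3 := integrable_polynomial_eval_mul hU hV p (derivative g)
  have hlaw := hU.map_eq_gaussianReal
  rw [hU0, ← hu] at hlaw
  -- if `U` is degenerate then `U = 0` and both sides vanish
  by_cases hu0 : u = 0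
  · have hU00 : U =ᵐ[P] fun _ ↦ 0 := by
      have h := ae_eq_integral_of_variance_eq_zero hU.memLp_two (hu.symm.trans hu0)
      filter_upwards [h] with ω hω
      rw [hω, hU0]
    have hρ0 : ρ = 0 := by
      rw [hρ, covariance, hU0]
      rw [integral_congr_ae (g := fun _ ↦ (0 : ℝ))]
      · simp
      · filter_upwards [hU00] with ω hω
        simp [hω]
    rw [hu0, hρ0, integral_congr_ae (g := fun _ ↦ (0 : ℝ))]
    · simp
    · filter_upwards [hU00] with ω hω
      simp [hω]
  -- `W = V - b U` is independent of `U`, so Stein's identity applies for each fixed value of `W`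
  set b := ρ / u with hb
  set W : Ω → ℝ := fun ω ↦ V ω - b * U ω with hW
  have hUW : HasGaussianLaw (fun ω ↦ (U ω, W ω)) P := by
    have := hUV.map_fun ((ContinuousLinearMap.fst ℝ ℝ ℝ).prod
      (ContinuousLinearMap.snd ℝ ℝ ℝ - b • ContinuousLinearMap.fst ℝ ℝ ℝ))
    simpa [hW] using this
  have mW := hUW.snd.aemeasurable
  have hcov : cov[U, W; P] = 0 := by
    have : W = V - b • U := by ext ω; simp [hW]
    rw [this, covariance_sub_right hU.memLp_two hV.memLp_two (hU.memLp_two.const_smul b),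
      covariance_smul_right, covariance_self mU, ← hu, ← hρ, hb]
    field_simp; ring
  have hind := hUW.indepFun_of_covariance_eq_zero hcov
  have hprod := (indepFun_iff_map_prod_eq_prod_map_map mU mW).1 hind
  rw [hlaw] at hprod
  set F : ℝ × ℝ → ℝ := fun z ↦ z.1 * p.eval z.1 * g.eval (b * z.1 + z.2)
    - u * ((derivative p).eval z.1 * g.eval (b * z.1 + z.2))
    - ρ * (p.eval z.1 * (derivative g).eval (b * z.1 + z.2)) with hF
  have hFm : StronglyMeasurable F := by
    apply Continuous.stronglyMeasurable
    simp only [hF]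
    fun_prop
  have hFP : (fun ω ↦ F (U ω, W ω)) = fun ω ↦ U ω * p.eval (U ω) * g.eval (V ω)
      - u * ((derivative p).eval (U ω) * g.eval (V ω))
      - ρ * (p.eval (U ω) * (derivative g).eval (V ω)) := by
    ext ω; simp [hF, hW]
  have hFi : Integrable (fun ω ↦ F (U ω, W ω)) P := by
    rw [hFP]; exact (i1.sub (i2.const_mul u)).sub (i3.const_mul ρ)
  have hzero : ∫ ω, F (U ω, W ω) ∂P = 0 := by
    rw [← integral_map (φ := fun ω ↦ (U ω, W ω)) (f := F) (mU.prodMk mW)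
      hFm.aestronglyMeasurable, hprod, integral_prod_symm]
    · refine integral_eq_zero_of_ae (ae_of_all _ fun w ↦ ?_)
      have st := integral_id_mul_polynomial_gaussianReal u.toNNReal
        (p * g.comp (C b * X + C w))
      have hur : (u.toNNReal : ℝ) = u := Real.coe_toNNReal _ (variance_nonneg _ _)
      rw [hur, ← integral_const_mul, ← sub_eq_zero, ← integral_sub] at st
      · refine Eq.trans ?_ st
        refine integral_congr_ae (ae_of_all _ fun x ↦ ?_)
        have hub : u * b = ρ := by rw [hb]; field_simp
        simp only [hF, eval_mul, eval_comp, eval_add, eval_C, eval_X, derivative_mul,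
          derivative_comp, derivative_add, derivative_C, derivative_X, add_zero, mul_one,
          zero_mul, zero_add]
        rw [← hub]; ring
      · exact (integrable_polynomial_eval_gaussianReal u.toNNReal
          (X * (p * g.comp (C b * X + C w)))).congr (ae_of_all _ fun x ↦ by simp)
      · exact (integrable_polynomial_eval_gaussianReal _ _).const_mul _
    · rw [← hprod, integrable_map_measure hFm.aestronglyMeasurable (mU.prodMk mW)]
      exact hFi
  rw [hFP, integral_sub (f := fun ω ↦ U ω * p.eval (U ω) * g.eval (V ω)
      - u * ((derivative p).eval (U ω) * g.eval (V ω))) (i1.sub (i2.const_mul u)) (i3.const_mul ρ),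
    integral_sub i1 (i2.const_mul u), integral_const_mul, integral_const_mul] at hzero
  linarith

lemma integral_polynomial_eval_eq_gaussianReal (hU : HasGaussianLaw U P)
    (hU0 : ∫ ω, U ω ∂P = 0) (p : ℝ[X]) :
    ∫ ω, p.eval (U ω) ∂P = ∫ x, p.eval x ∂gaussianReal 0 Var[U; P].toNNReal := by
  have h := hU.map_eq_gaussianReal
  rw [hU0] at h
  rw [← h, integral_map hU.aemeasurable]
  exact p.continuous.aestronglyMeasurable

lemma integral_mul_polynomial_of_gaussian (hU : HasGaussianLaw U P)
    (hU0 : ∫ ω, U ω ∂P = 0) (p : ℝ[X]) :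
    ∫ ω, U ω * p.eval (U ω) ∂P = Var[U; P] * ∫ ω, (derivative p).eval (U ω) ∂P := by
  have h := integral_id_mul_polynomial_gaussianReal Var[U; P].toNNReal p
  rw [Real.coe_toNNReal _ (variance_nonneg _ _)] at h
  rw [integral_polynomial_eval_eq_gaussianReal hU hU0, ← h]
  have e := integral_polynomial_eval_eq_gaussianReal hU hU0 (X * p)
  simp only [eval_mul, eval_X] at e
  exact e

lemma exists_abs_integral_polynomial_gaussianReal_le (M : ℝ) (p : ℝ[X]) :
    ∃ C, ∀ v : ℝ≥0, (v : ℝ) ≤ M → |∫ x, p.eval x ∂gaussianReal 0 v| ≤ C := by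
  induction p using Polynomial.induction_on' with
  | add p q hp hq =>
    obtain ⟨C₁, h₁⟩ := hp
    obtain ⟨C₂, h₂⟩ := hq
    refine ⟨C₁ + C₂, fun v hv ↦ ?_⟩
    simp only [eval_add]
    rw [integral_add (integrable_polynomial_eval_gaussianReal v p)
      (integrable_polynomial_eval_gaussianReal v q)]
    exact (abs_add_le _ _).trans (add_le_add (h₁ v hv) (h₂ v hv))
  | monomial n a =>
    suffices ∃ C, ∀ v : ℝ≥0, (v : ℝ) ≤ M → |∫ x, x ^ n ∂gaussianReal 0 v| ≤ C by
      obtain ⟨C, h⟩ := this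
      refine ⟨|a| * C, fun v hv ↦ ?_⟩
      simp only [eval_monomial]
      rw [integral_const_mul, abs_mul]
      exact mul_le_mul_of_nonneg_left (h v hv) (abs_nonneg a)
    induction n using Nat.strong_induction_on with
    | _ n ih =>
      match n, ih with
      | 0, _ => exact ⟨1, fun v _ ↦ by simp⟩
      | 1, _ => exact ⟨0, fun v _ ↦ by simp⟩
      | n + 2, ih =>
        obtain ⟨C, h⟩ := ih n (by omega)
        refine ⟨M * ((n + 1 : ℕ) * C), fun v hv ↦ ?_⟩
        have st := integral_id_mul_polynomial_gaussianReal v (X ^ (n + 1))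
        have e : ∀ x : ℝ, x * (X ^ (n + 1) : ℝ[X]).eval x = x ^ (n + 2) := fun x ↦ by
          simp; ring
        have e' : ∀ x : ℝ, (derivative (X ^ (n + 1) : ℝ[X])).eval x = (n + 1 : ℕ) * x ^ n :=
          fun x ↦ by simp
        simp only [e, e', integral_const_mul] at st
        rw [st, abs_mul, abs_mul, NNReal.abs_eq, Nat.abs_cast]
        have h0 : (0 : ℝ) ≤ v := v.2
        gcongr
        · exact h0.trans hv
        · exact h v hv

lemma exists_abs_integral_mul_polynomial_le (P : Measure Ω) (M : ℝ) (p g : ℝ[X]) :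
    ∃ C, ∀ U V : Ω → ℝ, HasGaussianLaw U P → HasGaussianLaw V P → ∫ ω, U ω ∂P = 0 →
      ∫ ω, V ω ∂P = 0 → Var[U; P] ≤ M → Var[V; P] ≤ M →
      |∫ ω, p.eval (U ω) * g.eval (V ω) ∂P| ≤ C := by
  obtain ⟨C₁, h₁⟩ := exists_abs_integral_polynomial_gaussianReal_le M (p ^ 2)
  obtain ⟨C₂, h₂⟩ := exists_abs_integral_polynomial_gaussianReal_le M (g ^ 2)
  refine ⟨C₁ + C₂, fun U V hU hV hU0 hV0 hUM hVM ↦ ?_⟩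
  have k₁ := h₁ Var[U; P].toNNReal (by rwa [Real.coe_toNNReal _ (variance_nonneg _ _)])
  have k₂ := h₂ Var[V; P].toNNReal (by rwa [Real.coe_toNNReal _ (variance_nonneg _ _)])
  rw [← integral_polynomial_eval_eq_gaussianReal hU hU0] at k₁
  rw [← integral_polynomial_eval_eq_gaussianReal hV hV0] at k₂
  calc |∫ ω, p.eval (U ω) * g.eval (V ω) ∂P|
      ≤ ∫ ω, |p.eval (U ω) * g.eval (V ω)| ∂P := abs_integral_le_integral_abs
    _ ≤ ∫ ω, ((p ^ 2).eval (U ω) + (g ^ 2).eval (V ω)) ∂P := by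
      refine integral_mono (integrable_polynomial_eval_mul hU hV p g).abs
        ((hU.integrable_polynomial_eval _).add (hV.integrable_polynomial_eval _)) fun ω ↦ ?_
      simp only [eval_pow, abs_mul]
      nlinarith [sq_nonneg (|p.eval (U ω)| - |g.eval (V ω)|), sq_abs (p.eval (U ω)),
        sq_abs (g.eval (V ω)), sq_nonneg (p.eval (U ω)), sq_nonneg (g.eval (V ω))]
    _ = ∫ ω, (p ^ 2).eval (U ω) ∂P + ∫ ω, (g ^ 2).eval (V ω) ∂P :=
      integral_add (hU.integrable_polynomial_eval _) (hV.integrable_polynomial_eval _)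
    _ ≤ C₁ + C₂ := add_le_add ((le_abs_self _).trans k₁) ((le_abs_self _).trans k₂)

/-- Recursion in the degree of the first polynomial; the last term carries a factor
`Cov(U, V)`. -/
lemma covariance_X_mul_polynomial_of_gaussian_pair
    (hUV : HasGaussianLaw (fun ω ↦ (U ω, V ω)) P) (hU0 : ∫ ω, U ω ∂P = 0) (p g : ℝ[X]) :
    cov[fun ω ↦ (X * p).eval (U ω), fun ω ↦ g.eval (V ω); P]
      = Var[U; P] * cov[fun ω ↦ (derivative p).eval (U ω), fun ω ↦ g.eval (V ω); P]
        + cov[U, V; P] * ∫ ω, p.eval (U ω) * (derivative g).eval (V ω) ∂P := by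
  have := hUV.isProbabilityMeasure
  rw [covariance_eq_sub (hUV.fst.memLp_two_polynomial_eval _)
      (hUV.snd.memLp_two_polynomial_eval _),
    covariance_eq_sub (hUV.fst.memLp_two_polynomial_eval _)
      (hUV.snd.memLp_two_polynomial_eval _)]
  have h1 := integral_mul_polynomial_of_gaussian_pair hUV hU0 p g
  have h2 := integral_mul_polynomial_of_gaussian hUV.fst hU0 p
  simp only [eval_mul, eval_X, Pi.mul_apply]
  rw [h1, h2]
  ring

/-- For centred jointly Gaussian variables with bounded variances, the covariance of polynomials
of the two variables is controlled linearly by the covariance of the variables. -/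
lemma exists_abs_covariance_polynomial_le (P : Measure Ω) (M : ℝ) (p g : ℝ[X]) :
    ∃ C, ∀ U V : Ω → ℝ, HasGaussianLaw (fun ω ↦ (U ω, V ω)) P → ∫ ω, U ω ∂P = 0 →
      ∫ ω, V ω ∂P = 0 → Var[U; P] ≤ M → Var[V; P] ≤ M →
      |cov[fun ω ↦ p.eval (U ω), fun ω ↦ g.eval (V ω); P]| ≤ C * |cov[U, V; P]| := by
  induction p using Polynomial.induction_on' with
  | add p q hp hq =>
    obtain ⟨C₁, h₁⟩ := hp
    obtain ⟨C₂, h₂⟩ := hq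
    refine ⟨C₁ + C₂, fun U V hUV hU0 hV0 hUM hVM ↦ ?_⟩
    have := hUV.isProbabilityMeasure
    simp only [eval_add]
    rw [← Pi.add_def, covariance_add_left (hUV.fst.memLp_two_polynomial_eval _)
      (hUV.fst.memLp_two_polynomial_eval _) (hUV.snd.memLp_two_polynomial_eval _), add_mul]
    exact (abs_add_le _ _).trans
      (add_le_add (h₁ U V hUV hU0 hV0 hUM hVM) (h₂ U V hUV hU0 hV0 hUM hVM))
  | monomial n a =>
    suffices ∃ C, ∀ U V : Ω → ℝ, HasGaussianLaw (fun ω ↦ (U ω, V ω)) P → ∫ ω, U ω ∂P = 0 →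
        ∫ ω, V ω ∂P = 0 → Var[U; P] ≤ M → Var[V; P] ≤ M →
        |cov[fun ω ↦ U ω ^ n, fun ω ↦ g.eval (V ω); P]| ≤ C * |cov[U, V; P]| by
      obtain ⟨C, h⟩ := this
      refine ⟨|a| * C, fun U V hUV hU0 hV0 hUM hVM ↦ ?_⟩
      simp only [eval_monomial]
      rw [covariance_const_mul_left, abs_mul, mul_assoc]
      exact mul_le_mul_of_nonneg_left (h U V hUV hU0 hV0 hUM hVM) (abs_nonneg a)
    induction n using Nat.strong_induction_on with
    | _ n ih =>
      match n, ih with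
      | 0, _ =>
        refine ⟨0, fun U V hUV _ _ _ _ ↦ ?_⟩
        have := hUV.isProbabilityMeasure
        simp
      | 1, _ =>
        obtain ⟨C, h⟩ := exists_abs_integral_mul_polynomial_le P M 1 (derivative g)
        refine ⟨C, fun U V hUV hU0 hV0 hUM hVM ↦ ?_⟩
        have := hUV.isProbabilityMeasure
        have e := covariance_X_mul_polynomial_of_gaussian_pair hUV hU0 1 g
        have h' := h U V hUV.fst hUV.snd hU0 hV0 hUM hVM
        simp only [mul_one, eval_X, derivative_one, eval_zero, covariance_const_left, mul_zero,
          zero_add] at e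
        simp only [pow_one, e, abs_mul]
        rw [mul_comm]
        exact mul_le_mul_of_nonneg_right h' (abs_nonneg _)
      | n + 2, ih =>
        obtain ⟨C₁, h₁⟩ := exists_abs_integral_mul_polynomial_le P M (X ^ (n + 1)) (derivative g)
        obtain ⟨C₂, h₂⟩ := ih n (by omega)
        refine ⟨M * ((n + 1 : ℕ) * C₂) + C₁, fun U V hUV hU0 hV0 hUM hVM ↦ ?_⟩
        have e := covariance_X_mul_polynomial_of_gaussian_pair hUV hU0 (X ^ (n + 1)) g
        have e1 : ∀ x : ℝ, (X * X ^ (n + 1) : ℝ[X]).eval x = x ^ (n + 2) := fun x ↦ by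
          simp; ring
        have e2 : ∀ x : ℝ, (derivative (X ^ (n + 1) : ℝ[X])).eval x = (n + 1 : ℕ) * x ^ n :=
          fun x ↦ by simp
        simp only [e1, e2] at e
        rw [covariance_const_mul_left] at e
        rw [e, add_mul]
        refine (abs_add_le _ _).trans (add_le_add ?_ ?_)
        · have h0 := variance_nonneg U P
          have h2 := h₂ U V hUV hU0 hV0 hUM hVM
          rw [abs_mul, abs_mul, abs_of_nonneg h0, Nat.abs_cast, mul_assoc, mul_assoc]
          have hM := h0.trans hUM
          gcongr
        · rw [abs_mul, mul_comm]
          exact mul_le_mul_of_nonneg_right (h₁ U V hUV.fst hUV.snd hU0 hV0 hUM hVM)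
            (abs_nonneg _)

/-! ### Hermite polynomials of a Gaussian variable -/

lemma derivative_hermite_succ (n : ℕ) :
    derivative (hermite (n + 1)) = ((n + 1 : ℕ) : ℤ[X]) * hermite n := by
  induction n with
  | zero => simp
  | succ n ih =>
    rw [hermite_succ (n + 1), derivative_sub, derivative_mul, derivative_X, ih, derivative_mul,
      derivative_natCast, hermite_succ n]
    push_cast
    ring

/-- The Hermite polynomials with real coefficients. -/
noncomputable abbrev realHermite (n : ℕ) : ℝ[X] := (hermite n).map (Int.castRingHom ℝ)

lemma aeval_hermite_eq_eval (n : ℕ) (x : ℝ) : aeval x (hermite n) = (realHermite n).eval x := by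
  rw [eval_map, aeval_def]; rfl

lemma realHermite_succ (n : ℕ) :
    realHermite (n + 1) = X * realHermite n - derivative (realHermite n) := by
  simp [realHermite, hermite_succ, derivative_map]

lemma derivative_realHermite_succ (n : ℕ) :
    derivative (realHermite (n + 1)) = C ((n + 1 : ℕ) : ℝ) * realHermite n := by
  rw [derivative_map, derivative_hermite_succ]
  simp

lemma integral_realHermite_add_two (hU : HasGaussianLaw U P) (hU0 : ∫ ω, U ω ∂P = 0) (n : ℕ) :
    ∫ ω, (realHermite (n + 2)).eval (U ω) ∂P
      = (n + 1 : ℕ) * (Var[U; P] - 1) * ∫ ω, (realHermite n).eval (U ω) ∂P := by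
  have i1 : Integrable (fun ω ↦ U ω * (realHermite (n + 1)).eval (U ω)) P :=
    (hU.integrable_polynomial_eval (X * realHermite (n + 1))).congr
      (ae_of_all _ fun ω ↦ by simp)
  have st := integral_mul_polynomial_of_gaussian hU hU0 (realHermite (n + 1))
  simp only [realHermite_succ (n + 1), eval_sub, eval_mul, eval_X]
  rw [integral_sub i1 (hU.integrable_polynomial_eval _), st, derivative_realHermite_succ]
  simp only [eval_mul, eval_C, integral_const_mul]
  ring

/-- `E[H_{2m}(U)] = (2m)! / (m! 2 ^ m) (v - 1) ^ m` for `U` centred Gaussian of variance `v`. -/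
lemma integral_realHermite_two_mul (hU : HasGaussianLaw U P) (hU0 : ∫ ω, U ω ∂P = 0) (m : ℕ) :
    ∫ ω, (realHermite (2 * m)).eval (U ω) ∂P
      = ((2 * m).factorial : ℝ) / ((m.factorial : ℝ) * 2 ^ m) * (Var[U; P] - 1) ^ m := by
  have := hU.isProbabilityMeasure
  induction m with
  | zero => simp [realHermite]
  | succ m ih =>
    have e : 2 * (m + 1) = 2 * m + 2 := by ring
    rw [e, integral_realHermite_add_two hU hU0, ih, Nat.factorial_succ, Nat.factorial_succ,
      Nat.factorial_succ, pow_succ, pow_succ]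
    have : (m.factorial : ℝ) ≠ 0 := by exact_mod_cast m.factorial_ne_zero
    push_cast
    field_simp
    ring

end GaussianPolynomials

/-! ### Gaussian limits and integrals of Gaussian processes -/

section GaussianIntegrals

variable {Ω : Type*} [MeasurableSpace Ω] {P : Measure Ω}

/-- An almost sure limit of centred Gaussian variables whose variances converge is Gaussian. -/
lemma map_eq_gaussianReal_of_tendsto [IsProbabilityMeasure P] {Y : ℕ → Ω → ℝ} {Z : Ω → ℝ}
    {v : ℝ} (hY : ∀ n, HasGaussianLaw (Y n) P) (hY0 : ∀ n, ∫ ω, Y n ω ∂P = 0)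
    (hv : Tendsto (fun n ↦ Var[Y n; P]) atTop (𝓝 v))
    (hYZ : ∀ᵐ ω ∂P, Tendsto (fun n ↦ Y n ω) atTop (𝓝 (Z ω))) :
    AEMeasurable Z P ∧ 0 ≤ v ∧ P.map Z = gaussianReal 0 v.toNNReal := by
  have mZ : AEMeasurable Z P :=
    aemeasurable_of_tendsto_metrizable_ae atTop (fun n ↦ (hY n).aemeasurable) hYZ
  have hv0 : 0 ≤ v := ge_of_tendsto' hv fun n ↦ variance_nonneg _ _
  refine ⟨mZ, hv0, ?_⟩
  have : IsProbabilityMeasure (P.map Z) := Measure.isProbabilityMeasure_map mZ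
  refine Measure.ext_of_charFun ?_
  ext t
  have key : ∀ W : Ω → ℝ, AEMeasurable W P →
      charFun (P.map W) t = ∫ ω, Complex.exp (t * W ω * Complex.I) ∂P := fun W hW ↦ by
    rw [charFun_apply_real, integral_map hW]
    exact Continuous.aestronglyMeasurable (by fun_prop)
  have h1 : Tendsto (fun n ↦ charFun (P.map (Y n)) t) atTop (𝓝 (charFun (P.map Z) t)) := by
    rw [key Z mZ]
    simp_rw [fun n ↦ key (Y n) (hY n).aemeasurable]
    refine tendsto_integral_of_dominated_convergence (fun _ ↦ (1 : ℝ)) (fun n ↦ ?_)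
      (integrable_const 1) (fun n ↦ ae_of_all _ fun ω ↦ ?_) ?_
    · have := (hY n).aemeasurable
      have hc : Continuous fun y : ℝ ↦ Complex.exp (t * y * Complex.I) := by fun_prop
      exact (hc.measurable.comp_aemeasurable this).aestronglyMeasurable
    · have : (t : ℂ) * Y n ω * Complex.I = ((t * Y n ω : ℝ) : ℂ) * Complex.I := by push_cast; ring
      rw [this, Complex.norm_exp_ofReal_mul_I]
    · filter_upwards [hYZ] with ω hω
      have hc : Continuous fun y : ℝ ↦ Complex.exp (t * y * Complex.I) := by fun_prop
      exact (hc.tendsto (Z ω)).comp hω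
  have h2 : Tendsto (fun n ↦ charFun (P.map (Y n)) t) atTop
      (𝓝 (charFun (gaussianReal 0 v.toNNReal) t)) := by
    simp_rw [fun n ↦ (hY n).map_eq_gaussianReal, hY0, charFun_gaussianReal]
    have hc : Continuous fun y : ℝ ↦ Complex.exp (t * (0 : ℝ) * Complex.I - y * t ^ 2 / 2) := by
      fun_prop
    have := (hc.tendsto v).comp hv
    rw [Real.coe_toNNReal _ hv0]
    refine this.congr fun n ↦ ?_
    simp only [Function.comp_apply]
    rw [Real.coe_toNNReal _ (variance_nonneg _ _)]
  exact tendsto_nhds_unique h1 h2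

lemma hasGaussianLaw_of_map_eq_gaussianReal {Z : Ω → ℝ} {v : ℝ≥0} {m : ℝ}
    (hZ : AEMeasurable Z P) (h : P.map Z = gaussianReal m v) :
    HasGaussianLaw Z P ∧ ∫ ω, Z ω ∂P = m ∧ Var[Z; P] = v := by
  refine ⟨⟨h ▸ inferInstance⟩, ?_, ?_⟩
  · have : ∫ ω, Z ω ∂P = ∫ x, x ∂(P.map Z) :=
      (integral_map (f := fun x ↦ x) hZ (by fun_prop)).symm
    rw [this, h, integral_id_gaussianReal]
  · have : Var[id; P.map Z] = Var[id ∘ Z; P] := variance_map (by fun_prop) hZ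
    rw [Function.id_comp] at this
    rw [← this, h, variance_id_gaussianReal]

lemma integral_simpleFunc_comp {α : Type*} [MeasurableSpace α] (ν : Measure α)
    [IsFiniteMeasure ν] (φ : SimpleFunc α α) (f : α → ℝ) :
    ∫ x, f (φ x) ∂ν = ∑ y ∈ φ.range, ν.real (φ ⁻¹' {y}) * f y := by
  have h : ∀ x, f (φ x) = ∑ y ∈ φ.range, (φ ⁻¹' {y}).indicator (fun _ ↦ f y) x := fun x ↦ by
    rw [Finset.sum_eq_single_of_mem (φ x) (φ.mem_range_self x)]
    · simp
    · intro y _ hy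
      exact Set.indicator_of_notMem (fun h ↦ hy h.symm) _
  simp_rw [h]
  rw [integral_finsetSum]
  · refine Finset.sum_congr rfl fun y _ ↦ ?_
    rw [integral_indicator_const _ (φ.measurableSet_fiber y), smul_eq_mul]
  · exact fun y _ ↦ (integrable_const _).indicator (φ.measurableSet_fiber y)

/-- The integral of a centred Gaussian process with continuous bounded paths against a probability
measure is a centred Gaussian variable, and its variance is the double integral of the covariance
function. -/
lemma map_integral_gaussianProcess [IsProbabilityMeasure P] {F : ℝ → Ω → ℝ} {Z : Ω → ℝ}
    (ν : Measure ℝ) [IsProbabilityMeasure ν] (hF : IsGaussianProcess F P)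
    (hF0 : ∀ x, ∫ ω, F x ω ∂P = 0) {K : ℝ → ℝ → ℝ} (hK : ∀ x y, cov[F x, F y; P] = K x y)
    (hKc : Continuous (Function.uncurry K)) {C : ℝ} (hKC : ∀ x y, |K x y| ≤ C)
    (hFc : ∀ᵐ ω ∂P, Continuous fun x ↦ F x ω) (hFb : ∀ᵐ ω ∂P, ∃ D, ∀ x, |F x ω| ≤ D)
    (hZ : ∀ᵐ ω ∂P, Z ω = ∫ x, F x ω ∂ν) :
    HasGaussianLaw Z P ∧ ∫ ω, Z ω ∂P = 0 ∧ Var[Z; P] = ∫ x, ∫ y, K x y ∂ν ∂ν := by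
  set φ : ℕ → SimpleFunc ℝ ℝ := fun n ↦ (stronglyMeasurable_id (α := ℝ)).approx n with hφ
  have hφt : ∀ x, Tendsto (fun n ↦ φ n x) atTop (𝓝 x) := fun x ↦
    (stronglyMeasurable_id (α := ℝ)).tendsto_approx x
  set Y : ℕ → Ω → ℝ := fun n ω ↦ ∫ x, F (φ n x) ω ∂ν with hYdef
  have hYs : ∀ n, Y n = fun ω ↦ ∑ y ∈ (φ n).range, ν.real (φ n ⁻¹' {y}) * F y ω := fun n ↦ by
    ext ω
    exact integral_simpleFunc_comp ν (φ n) fun y ↦ F y ω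
  have hY : ∀ n, HasGaussianLaw (Y n) P := fun n ↦ by
    rw [hYs]
    exact (hF.smul fun y ↦ ν.real (φ n ⁻¹' {y})).hasGaussianLaw_fun_sum
  have hFL : ∀ x, MemLp (F x) 2 P := fun x ↦ (hF.hasGaussianLaw_eval x).memLp_two
  have hY0 : ∀ n, ∫ ω, Y n ω ∂P = 0 := fun n ↦ by
    rw [hYs, integral_finsetSum]
    · simp [integral_const_mul, hF0]
    · exact fun y _ ↦ ((hF.hasGaussianLaw_eval y).integrable).const_mul _
  have hvar : ∀ n, Var[Y n; P] = ∫ x, ∫ y, K (φ n x) (φ n y) ∂ν ∂ν := fun n ↦ by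
    rw [← covariance_self (hY n).aemeasurable, hYs,
      covariance_fun_sum_fun_sum' (fun y _ ↦ (hFL y).const_mul _)
        (fun y _ ↦ (hFL y).const_mul _)]
    simp_rw [fun x ↦ integral_simpleFunc_comp ν (φ n) (fun y ↦ K x y)]
    rw [integral_simpleFunc_comp ν (φ n)
      (fun x ↦ ∑ y ∈ (φ n).range, ν.real (φ n ⁻¹' {y}) * K x y)]
    refine Finset.sum_congr rfl fun x _ ↦ ?_
    rw [Finset.mul_sum]
    refine Finset.sum_congr rfl fun y _ ↦ ?_
    rw [covariance_const_mul_left, covariance_const_mul_right, hK]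
  have hC0 : 0 ≤ C := (abs_nonneg _).trans (hKC 0 0)
  have hinner : ∀ x, Tendsto (fun n ↦ ∫ y, K (φ n x) (φ n y) ∂ν) atTop
      (𝓝 (∫ y, K x y ∂ν)) := fun x ↦ by
    refine tendsto_integral_of_dominated_convergence (fun _ ↦ C) (fun n ↦ ?_)
      (integrable_const C) (fun n ↦ ae_of_all _ fun y ↦ by simpa using hKC _ _)
      (ae_of_all _ fun y ↦ ?_)
    · exact (((φ n).map fun y ↦ K (φ n x) y).measurable).aestronglyMeasurable
    · exact (hKc.tendsto (x, y)).comp ((hφt x).prodMk_nhds (hφt y))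
  have hvt : Tendsto (fun n ↦ Var[Y n; P]) atTop (𝓝 (∫ x, ∫ y, K x y ∂ν ∂ν)) := by
    simp_rw [hvar]
    refine tendsto_integral_of_dominated_convergence (fun _ ↦ C) (fun n ↦ ?_)
      (integrable_const C) (fun n ↦ ae_of_all _ fun x ↦ ?_) (ae_of_all _ hinner)
    · exact (((φ n).map fun x ↦ ∫ y, K x (φ n y) ∂ν).measurable).aestronglyMeasurable
    · refine (norm_integral_le_of_norm_le_const (C := C) (ae_of_all _ fun y ↦ ?_)).trans
        (by simp)
      simpa using hKC _ _
  have hYZ : ∀ᵐ ω ∂P, Tendsto (fun n ↦ Y n ω) atTop (𝓝 (Z ω)) := by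
    filter_upwards [hFc, hFb, hZ] with ω hc ⟨D, hD⟩ hZω
    rw [hZω]
    refine tendsto_integral_of_dominated_convergence (fun _ ↦ D) (fun n ↦ ?_)
      (integrable_const D) (fun n ↦ ae_of_all _ fun y ↦ by simpa using hD _)
      (ae_of_all _ fun y ↦ ?_)
    · exact (((φ n).map fun y ↦ F y ω).measurable).aestronglyMeasurable
    · exact (hc.tendsto y).comp (hφt y)
  obtain ⟨mZ, hv0, hmap⟩ := map_eq_gaussianReal_of_tendsto hY hY0 hvt hYZ
  have := hasGaussianLaw_of_map_eq_gaussianReal mZ hmap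
  rwa [Real.coe_toNNReal _ hv0] at this

/-- Cramér–Wold: two variables all of whose linear combinations are Gaussian are jointly
Gaussian. -/
lemma hasGaussianLaw_prodMk_of_linear_combinations {U V : Ω → ℝ}
    (h : ∀ a b : ℝ, HasGaussianLaw (fun ω ↦ a * U ω + b * V ω) P) :
    HasGaussianLaw (fun ω ↦ (U ω, V ω)) P := by
  have mU : AEMeasurable U P := by simpa using (h 1 0).aemeasurable
  have mV : AEMeasurable V P := by simpa using (h 0 1).aemeasurable
  refine ⟨⟨fun L ↦ ?_⟩⟩
  have hL : (fun ω ↦ L (U ω, V ω)) = fun ω ↦ L (1, 0) * U ω + L (0, 1) * V ω := by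
    ext ω
    have : (U ω, V ω) = U ω • ((1 : ℝ), (0 : ℝ)) + V ω • ((0 : ℝ), (1 : ℝ)) := by simp
    rw [this, map_add, map_smul, map_smul]
    simp [mul_comm]
  have hm := (h (L (1, 0)) (L (0, 1))).map_eq_gaussianReal
  rw [← hL] at hm
  rw [AEMeasurable.map_map_of_aemeasurable (by fun_prop) (mU.prodMk mV),
    integral_map (mU.prodMk mV) (by fun_prop), variance_map (by fun_prop) (mU.prodMk mV)]
  exact hm

end GaussianIntegrals

/-! ### The exponential law -/

section ExponentialLaw

variable {θ : ℝ}

lemma expMeasure_eq_withDensity_restrict (θ : ℝ) :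
    expMeasure θ = (volume.restrict (Set.Ioi (0 : ℝ))).withDensity
      fun x ↦ ENNReal.ofReal (θ * Real.exp (-(θ * x))) := by
  rw [← withDensity_indicator measurableSet_Ioi]
  refine withDensity_congr_ae ?_
  filter_upwards [compl_mem_ae_iff.2 (measure_singleton (μ := volume) (0 : ℝ))] with x hx
  change exponentialPDF θ x = _
  rcases lt_or_gt_of_ne (show x ≠ 0 from hx) with h | h
  · rw [exponentialPDF_of_neg h, Set.indicator_of_notMem (by simpa using h.le)]
  · rw [exponentialPDF_of_nonneg h.le, Set.indicator_of_mem (by simpa using h)]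

lemma ae_expMeasure_pos (θ : ℝ) : ∀ᵐ x ∂expMeasure θ, 0 < x := by
  rw [expMeasure_eq_withDensity_restrict]
  refine (withDensity_absolutelyContinuous _ _).ae_le ?_
  exact ae_restrict_mem measurableSet_Ioi

lemma integral_expMeasure (hθ : 0 < θ) (f : ℝ → ℝ) :
    ∫ x, f x ∂expMeasure θ = ∫ x in Set.Ioi 0, θ * Real.exp (-(θ * x)) * f x := by
  rw [expMeasure_eq_withDensity_restrict, integral_withDensity_eq_integral_toReal_smul
    (by fun_prop) (ae_of_all _ fun x ↦ ENNReal.ofReal_lt_top)]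
  refine integral_congr_ae (ae_of_all _ fun x ↦ ?_)
  simp only [smul_eq_mul]
  rw [ENNReal.toReal_ofReal (by positivity)]

lemma integrable_expMeasure_iff (hθ : 0 < θ) (f : ℝ → ℝ) :
    Integrable f (expMeasure θ) ↔
      IntegrableOn (fun x ↦ θ * Real.exp (-(θ * x)) * f x) (Set.Ioi 0) := by
  rw [expMeasure_eq_withDensity_restrict, integrable_withDensity_iff_integrable_smul'
    (by fun_prop) (ae_of_all _ fun x ↦ ENNReal.ofReal_lt_top), IntegrableOn]
  refine integrable_congr (ae_of_all _ fun x ↦ ?_)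
  simp only [smul_eq_mul]
  rw [ENNReal.toReal_ofReal (by positivity)]

lemma integrable_rpow_expMeasure (hθ : 0 < θ) {a : ℝ} (ha : 0 ≤ a) :
    Integrable (fun x : ℝ ↦ x ^ a) (expMeasure θ) := by
  rw [integrable_expMeasure_iff hθ]
  have h := (integrableOn_rpow_mul_exp_neg_mul_rpow (p := 1) (s := a) (b := θ) (by linarith)
    one_pos hθ).const_mul θ
  refine IntegrableOn.congr_fun h (fun x _ ↦ ?_) measurableSet_Ioi
  simp only [Real.rpow_one, neg_mul]
  ring

lemma integral_rpow_expMeasure (hθ : 0 < θ) {a : ℝ} (ha : 0 ≤ a) :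
    ∫ x, x ^ a ∂expMeasure θ = Real.Gamma (a + 1) * θ ^ (-a) := by
  rw [integral_expMeasure hθ]
  have h := Real.integral_rpow_mul_exp_neg_mul_Ioi (a := a + 1) (r := θ) (by linarith) hθ
  have e : ∀ x : ℝ, θ * Real.exp (-(θ * x)) * x ^ a
      = θ * (x ^ (a + 1 - 1) * Real.exp (-(θ * x))) := fun x ↦ by
    rw [add_sub_cancel_right]; ring
  simp_rw [e]
  rw [integral_const_mul, h, one_div, Real.inv_rpow hθ.le, Real.rpow_add hθ, Real.rpow_neg hθ.le,
    Real.rpow_one]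
  field_simp

lemma integrable_one_add_pow_expMeasure (hθ : 0 < θ) (n : ℕ) :
    Integrable (fun x : ℝ ↦ (1 + |x|) ^ n) (expMeasure θ) := by
  have := isProbabilityMeasure_expMeasure hθ
  have h : Integrable (fun x : ℝ ↦ 2 ^ n * (1 + x ^ (n : ℝ))) (expMeasure θ) :=
    ((integrable_const 1).add (integrable_rpow_expMeasure hθ (Nat.cast_nonneg n))).const_mul _
  refine h.mono' (by fun_prop) ?_
  filter_upwards [ae_expMeasure_pos θ] with x hx
  rw [abs_of_pos hx, Real.norm_of_nonneg (by positivity), Real.rpow_natCast]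
  rcases le_total x 1 with h1 | h1
  · calc (1 + x) ^ n ≤ 2 ^ n := by gcongr; linarith
      _ ≤ 2 ^ n * (1 + x ^ n) := by
        have : 0 ≤ x ^ n := by positivity
        nlinarith [show (0 : ℝ) < 2 ^ n by positivity]
  · calc (1 + x) ^ n ≤ (2 * x) ^ n := by gcongr; linarith
      _ = 2 ^ n * x ^ n := mul_pow _ _ _
      _ ≤ 2 ^ n * (1 + x ^ n) := by gcongr; linarith

/-- The distance of two independent exponential variables is again exponential, so its moments
agree with those of a single one: half of the mass comes from each of the events `y < x` and
`x < y`, where lack of memory applies. -/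
lemma integral_integral_abs_sub_rpow_expMeasure (hθ : 0 < θ) {a : ℝ} (ha : 0 < a) :
    ∫ x, ∫ y, |x - y| ^ a ∂expMeasure θ ∂expMeasure θ = Real.Gamma (a + 1) * θ ^ (-a) := by
  have := isProbabilityMeasure_expMeasure hθ
  set m : ℝ → ℝ := fun z ↦ (max z 0) ^ a with hm
  have hmc : Continuous m := by
    simp only [hm]
    exact (continuous_id.max continuous_const).rpow_const fun _ ↦ Or.inr ha.le
  have hm0 : ∀ z, z ≤ 0 → m z = 0 := fun z hz ↦ by
    simp only [hm]
    rw [max_eq_right hz, Real.zero_rpow ha.ne']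
  have habs : ∀ z : ℝ, |z| ^ a = m z + m (-z) := fun z ↦ by
    rcases le_total z 0 with hz | hz
    · rw [hm0 z hz, zero_add, abs_of_nonpos hz]
      simp only [hm]
      rw [max_eq_left (neg_nonneg.2 hz)]
    · rw [hm0 (-z) (neg_nonpos.2 hz), add_zero, abs_of_nonneg hz]
      simp only [hm]
      rw [max_eq_left hz]
  have hmM : ∫ z, m z ∂expMeasure θ = Real.Gamma (a + 1) * θ ^ (-a) := by
    rw [← integral_rpow_expMeasure hθ ha.le]
    refine integral_congr_ae ?_
    filter_upwards [ae_expMeasure_pos θ] with x hx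
    simp only [hm]
    rw [max_eq_left hx.le]
  have hfull : ∀ x, 0 ≤ x → ∫ y, m (y - x) ∂expMeasure θ
      = ∫ y, θ * Real.exp (-(θ * y)) * m (y - x) := fun x hx ↦ by
    rw [integral_expMeasure hθ]
    refine setIntegral_eq_integral_of_forall_compl_eq_zero fun y hy ↦ ?_
    rw [hm0 _ (by simp only [Set.mem_Ioi, not_lt] at hy; linarith), mul_zero]
  have hinner : ∀ x, 0 ≤ x → ∫ y, m (y - x) ∂expMeasure θ
      = Real.exp (-(θ * x)) * (Real.Gamma (a + 1) * θ ^ (-a)) := fun x hx ↦ by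
    rw [hfull x hx, ← hmM]
    have h0 := hfull 0 le_rfl
    simp only [sub_zero] at h0
    rw [h0, ← integral_const_mul,
      ← integral_add_right_eq_self (fun y ↦ θ * Real.exp (-(θ * y)) * m (y - x)) x]
    refine integral_congr_ae (ae_of_all _ fun z ↦ ?_)
    simp only [add_sub_cancel_right]
    rw [show -(θ * (z + x)) = -(θ * x) + -(θ * z) by ring, Real.exp_add]
    ring
  have hhalf : ∫ x, Real.exp (-(θ * x)) ∂expMeasure θ = 1 / 2 := by
    rw [integral_expMeasure hθ]
    have h := Real.integral_rpow_mul_exp_neg_mul_Ioi (a := 1) (r := 2 * θ) one_pos (by positivity)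
    simp only [sub_self, Real.rpow_zero, one_mul, Real.rpow_one, Real.Gamma_one, mul_one] at h
    have e : ∀ x : ℝ, θ * Real.exp (-(θ * x)) * Real.exp (-(θ * x))
        = θ * Real.exp (-(2 * θ * x)) := fun x ↦ by
      rw [mul_assoc, ← Real.exp_add]; ring_nf
    simp_rw [e]
    rw [integral_const_mul, h]
    field_simp
  have hone : ∫ x, ∫ y, m (y - x) ∂expMeasure θ ∂expMeasure θ
      = Real.Gamma (a + 1) * θ ^ (-a) / 2 := by
    rw [integral_congr_ae (g := fun x ↦ Real.exp (-(θ * x)) * (Real.Gamma (a + 1) * θ ^ (-a)))]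
    · rw [integral_mul_const, hhalf]; ring
    · filter_upwards [ae_expMeasure_pos θ] with x hx
      exact hinner x hx.le
  obtain ⟨n, hn⟩ := exists_nat_ge a
  have hbound : ∀ x y : ℝ, ‖m (y - x)‖ ≤ (1 + |x|) ^ n * (1 + |y|) ^ n := fun x y ↦ by
    have h0 : 0 ≤ max (y - x) 0 := le_max_right _ _
    simp only [hm]
    rw [Real.norm_of_nonneg (by positivity), ← mul_pow, ← Real.rpow_natCast]
    have h1 : max (y - x) 0 ≤ (1 + |x|) * (1 + |y|) := by
      have := abs_nonneg x
      have := abs_nonneg y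
      refine max_le ?_ (by positivity)
      nlinarith [le_abs_self y, neg_abs_le x]
    refine (Real.rpow_le_rpow h0 h1 ha.le).trans (Real.rpow_le_rpow_of_exponent_le ?_ hn)
    nlinarith [abs_nonneg x, abs_nonneg y]
  have hmc2 : Continuous fun z : ℝ × ℝ ↦ m (z.2 - z.1) := by fun_prop
  have hint : Integrable (fun z : ℝ × ℝ ↦ m (z.2 - z.1)) ((expMeasure θ).prod (expMeasure θ)) :=
    ((integrable_one_add_pow_expMeasure hθ n).mul_prod
      (integrable_one_add_pow_expMeasure hθ n)).mono' hmc2.aestronglyMeasurable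
      (ae_of_all _ fun z ↦ hbound z.1 z.2)
  have hint' : Integrable (fun z : ℝ × ℝ ↦ m (z.1 - z.2)) ((expMeasure θ).prod (expMeasure θ)) :=
    hint.swap
  have e : ∀ x y : ℝ, |x - y| ^ a = m (x - y) + m (y - x) := fun x y ↦ by
    rw [habs, neg_sub]
  simp_rw [e]
  rw [integral_integral (f := fun x y ↦ m (x - y) + m (y - x)) (hint'.add hint),
    integral_add hint' hint, integral_prod_symm _ hint', integral_prod _ hint]
  simp only
  rw [hone]
  ring

end ExponentialLaw

/-! ### The pathwise solution of the Ornstein–Uhlenbeck equation -/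

/-- Variation of constants for the equation `x = -θ ∫ x + b`, written as an average of the
increments `b t - b (t - r)` over an exponentially distributed lag `r`; the subtraction in `ℝ≥0`
truncates the lag at `t`. -/
lemma eq_integral_increment_expMeasure {θ : ℝ} (hθ : 0 < θ) {x b : ℝ≥0 → ℝ} (hx0 : x 0 = 0)
    (hx : Continuous x) (hb : Continuous b)
    (h : ∀ t : ℝ≥0, x t = -θ * (∫ s in (0 : ℝ)..t, x s.toNNReal) + b t) (t : ℝ≥0) :
    x t = ∫ r, (b t - b (t - r.toNNReal)) ∂expMeasure θ := by
  have := isProbabilityMeasure_expMeasure hθ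
  have hb0 : b 0 = 0 := by
    have := h 0
    simpa [hx0] using this.symm
  have hxc : Continuous fun s : ℝ ↦ x s.toNNReal := by fun_prop
  have hbc : Continuous fun s : ℝ ↦ b s.toNNReal := by fun_prop
  set I : ℝ → ℝ := fun r ↦ ∫ s in (0 : ℝ)..r, x s.toNNReal with hI
  have hId : ∀ r, HasDerivAt I (x r.toNNReal) r := fun r ↦
    intervalIntegral.integral_hasDerivAt_right (hxc.intervalIntegrable _ _)
      (hxc.stronglyMeasurableAtFilter _ _) hxc.continuousAt
  have hJ : ∀ r ∈ Set.uIcc (0 : ℝ) t, HasDerivAt (fun r ↦ Real.exp (θ * r) * I r)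
      (Real.exp (θ * r) * b r.toNNReal) r := fun r hr ↦ by
    rw [Set.uIcc_of_le t.coe_nonneg] at hr
    have h1 : HasDerivAt (fun r : ℝ ↦ Real.exp (θ * r)) (Real.exp (θ * r) * θ) r := by
      simpa using ((hasDerivAt_id r).const_mul θ).exp
    refine (h1.mul (hId r)).congr_deriv ?_
    have h2 := h r.toNNReal
    rw [Real.coe_toNNReal _ hr.1] at h2
    have h3 : b r.toNNReal = x r.toNNReal + θ * I r := by rw [h2]; simp only [hI]; ring
    rw [h3]; ring
  have hsol : ∫ r in (0 : ℝ)..t, Real.exp (θ * r) * b r.toNNReal = Real.exp (θ * t) * I t := by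
    rw [intervalIntegral.integral_eq_sub_of_hasDerivAt hJ
      (by apply Continuous.intervalIntegrable; fun_prop)]
    simp [hI]
  have hbd : ∃ D, ∀ r : ℝ, |b (t - r.toNNReal)| ≤ D := by
    obtain ⟨D, hD⟩ := (isCompact_Icc (a := (0 : ℝ≥0)) (b := t)).exists_bound_of_continuousOn
      hb.continuousOn
    exact ⟨D, fun r ↦ hD _ ⟨zero_le, tsub_le_self⟩⟩
  obtain ⟨D, hD⟩ := hbd
  have hbi : Continuous fun r : ℝ ↦ b (t - r.toNNReal) := by fun_prop
  have hint : Integrable (fun r : ℝ ↦ b (t - r.toNNReal)) (expMeasure θ) :=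
    Integrable.of_bound hbi.aestronglyMeasurable D (ae_of_all _ hD)
  rw [integral_sub (integrable_const _) hint, integral_const, probReal_univ, one_smul]
  have hlag : ∫ r, b (t - r.toNNReal) ∂expMeasure θ = θ * I t := by
    have hint' := (integrable_expMeasure_iff hθ _).1 hint
    rw [integral_expMeasure hθ, ← Set.Ioc_union_Ioi_eq_Ioi (show (0 : ℝ) ≤ t from t.coe_nonneg),
      setIntegral_union (Set.Ioc_disjoint_Ioi le_rfl) measurableSet_Ioi
        (hint'.mono_set Set.Ioc_subset_Ioi_self) (hint'.mono_set (Set.Ioi_subset_Ioi t.coe_nonneg))]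
    have z : ∫ r in Set.Ioi (t : ℝ), θ * Real.exp (-(θ * r)) * b (t - r.toNNReal) = 0 := by
      refine setIntegral_eq_zero_of_forall_eq_zero fun r hr ↦ ?_
      have : t ≤ r.toNNReal := NNReal.le_toNNReal_of_coe_le (le_of_lt hr)
      rw [tsub_eq_zero_of_le this, hb0, mul_zero]
    have w : ∫ r in Set.Ioc (0 : ℝ) t, θ * Real.exp (-(θ * r)) * b (t - r.toNNReal)
        = ∫ r in (0 : ℝ)..t, θ * Real.exp (-(θ * t)) *
          (Real.exp (θ * (t - r)) * b (t - r : ℝ).toNNReal) := by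
      rw [intervalIntegral.integral_of_le t.coe_nonneg]
      refine setIntegral_congr_fun measurableSet_Ioc fun r hr ↦ ?_
      have e1 : (t - r.toNNReal : ℝ≥0) = (t - r : ℝ).toNNReal := by
        rw [NNReal.sub_def, Real.coe_toNNReal _ hr.1.le]
      have e2 : Real.exp (-(θ * r)) = Real.exp (-(θ * t)) * Real.exp (θ * (t - r)) := by
        rw [← Real.exp_add]; congr 1; ring
      rw [e1, e2]; ring
    rw [z, w, add_zero, intervalIntegral.integral_const_mul,
      intervalIntegral.integral_comp_sub_left (fun s ↦ Real.exp (θ * s) * b s.toNNReal) (t : ℝ),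
      sub_self, sub_zero, hsol, mul_assoc, ← mul_assoc (Real.exp _), ← Real.exp_add]
    simp
  rw [hlag, h t]
  ring

/-! ### Covariances of the fractional Ornstein–Uhlenbeck process -/

section Covariance

lemma abs_add_rpow_sub_rpow_le {a : ℝ} (ha0 : 0 < a) (ha2 : a < 2) {c p z : ℝ} (hc : 0 < c)
    (hz : c ≤ z) (hp : 0 ≤ p) : |(z + p) ^ (a - 1) - z ^ (a - 1)| ≤ c ^ (a - 2) * p := by
  have hder : ∀ w ∈ Set.Ici c, HasDerivWithinAt (fun w : ℝ ↦ w ^ (a - 1))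
      ((a - 1) * w ^ (a - 2)) (Set.Ici c) w := fun w hw ↦ by
    have hw0 : w ≠ 0 := (hc.trans_le hw).ne'
    refine ((Real.hasDerivAt_rpow_const (p := a - 1) (Or.inl hw0)).hasDerivWithinAt).congr_deriv ?_
    ring_nf
  have hbd : ∀ w ∈ Set.Ici c, ‖(a - 1) * w ^ (a - 2)‖ ≤ c ^ (a - 2) := fun w hw ↦ by
    have hw0 : 0 < w := hc.trans_le hw
    rw [norm_mul, Real.norm_eq_abs, Real.norm_of_nonneg (by positivity)]
    have h1 : |a - 1| ≤ 1 := abs_le.2 ⟨by linarith, by linarith⟩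
    have h2 : w ^ (a - 2) ≤ c ^ (a - 2) :=
      Real.rpow_le_rpow_of_nonpos hc hw (by linarith)
    have h3 : 0 ≤ w ^ (a - 2) := by positivity
    nlinarith [abs_nonneg (a - 1)]
  have := (convex_Ici c).norm_image_sub_le_of_norm_hasDerivWithin_le hder hbd
    (x := z) (y := z + p) hz (by simp only [Set.mem_Ici]; linarith)
  simpa [Real.norm_eq_abs, abs_of_nonneg hp] using this

/-- The second difference of `z ↦ |z| ^ a`, `0 < a < 2`, at distance `d` from the origin decays
like `d ^ (a - 2)`. For `q ≤ d / 2` this is the mean value theorem applied twice; for `q > d / 2`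
every term is at most polynomial in `p` and `q`, and `1 ≤ (2 q / d) ^ (2 - a)`. -/
lemma abs_second_difference_rpow_le {a : ℝ} (ha0 : 0 < a) (ha2 : a < 2) {d p q : ℝ} (hd : 0 < d)
    (hp : 0 ≤ p) (hq : 0 ≤ q) :
    |(|d - q| ^ a + |d + p| ^ a - |d| ^ a - |d + p - q| ^ a)|
      ≤ 144 * ((1 + p) ^ 4 * (1 + q) ^ 4) * d ^ (a - 2) := by
  have hdpos : 0 < d ^ (a - 2) := by positivity
  have hP : (1 : ℝ) ≤ 1 + p := by linarith
  have hQ : (1 : ℝ) ≤ 1 + q := by linarith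
  rcases le_or_gt q (d / 2) with hqd | hqd
  · rw [abs_of_nonneg (by linarith : 0 ≤ d - q), abs_of_nonneg (by linarith : 0 ≤ d + p),
      abs_of_pos hd, abs_of_nonneg (by linarith : 0 ≤ d + p - q)]
    have hc : 0 < d / 2 := by linarith
    have hder : ∀ w ∈ Set.Ici (d / 2), HasDerivWithinAt (fun w : ℝ ↦ (w + p) ^ a - w ^ a)
        (a * ((w + p) ^ (a - 1) - w ^ (a - 1))) (Set.Ici (d / 2)) w := fun w hw ↦ by
      have hw0 : 0 < w := hc.trans_le hw
      have h1 := (Real.hasDerivAt_rpow_const (p := a) (x := w) (Or.inl hw0.ne'))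
      have h2 := (Real.hasDerivAt_rpow_const (p := a) (x := w + p)
        (Or.inl (by positivity))).comp_add_const w p
      refine ((h2.sub h1).hasDerivWithinAt).congr_deriv ?_
      ring
    have hbd : ∀ w ∈ Set.Ici (d / 2), ‖a * ((w + p) ^ (a - 1) - w ^ (a - 1))‖
        ≤ 2 * ((d / 2) ^ (a - 2) * p) := fun w hw ↦ by
      rw [norm_mul, Real.norm_of_nonneg ha0.le, Real.norm_eq_abs]
      exact mul_le_mul ha2.le (abs_add_rpow_sub_rpow_le ha0 ha2 hc hw hp) (abs_nonneg _)
        (by norm_num)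
    have h := (convex_Ici (d / 2)).norm_image_sub_le_of_norm_hasDerivWithin_le hder hbd
      (x := d - q) (y := d) (by simp only [Set.mem_Ici]; linarith)
      (by simp only [Set.mem_Ici]; linarith)
    rw [sub_sub_cancel, Real.norm_of_nonneg hq, Real.norm_eq_abs] at h
    have e : (d - q) ^ a + (d + p) ^ a - d ^ a - (d + p - q) ^ a
        = (d + p) ^ a - d ^ a - ((d - q + p) ^ a - (d - q) ^ a) := by
      rw [show d - q + p = d + p - q by ring]; ring
    rw [e]
    refine h.trans ?_
    have h4 : (d / 2) ^ (a - 2) ≤ 4 * d ^ (a - 2) := by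
      rw [Real.div_rpow hd.le (by norm_num), div_eq_mul_inv, ← Real.rpow_neg (by norm_num),
        mul_comm]
      refine mul_le_mul_of_nonneg_right ?_ hdpos.le
      calc (2 : ℝ) ^ (-(a - 2)) ≤ 2 ^ (2 : ℝ) :=
            Real.rpow_le_rpow_of_exponent_le (by norm_num) (by linarith)
        _ = 4 := by norm_num
    have hp4 : p ≤ (1 + p) ^ 4 := by
      have := le_self_pow₀ hP (show (4 : ℕ) ≠ 0 by norm_num)
      linarith
    have hq4 : q ≤ (1 + q) ^ 4 := by
      have := le_self_pow₀ hQ (show (4 : ℕ) ≠ 0 by norm_num)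
      linarith
    calc 2 * ((d / 2) ^ (a - 2) * p) * q ≤ 2 * (4 * d ^ (a - 2) * (1 + p) ^ 4) * (1 + q) ^ 4 := by
          gcongr
      _ = 8 * ((1 + p) ^ 4 * (1 + q) ^ 4) * d ^ (a - 2) := by ring
      _ ≤ _ := by gcongr; norm_num
  · set M := 3 * ((1 + p) * (1 + q)) with hM
    have hM1 : 1 ≤ M := by nlinarith
    have hterm : ∀ z : ℝ, |z| ≤ M → |z| ^ a ≤ M ^ 2 := fun z hz ↦ by
      refine (Real.rpow_le_rpow (abs_nonneg z) hz ha0.le).trans ?_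
      rw [← Real.rpow_natCast]
      exact Real.rpow_le_rpow_of_exponent_le hM1 (by push_cast; exact ha2.le)
    have hpq : 0 ≤ p * q := mul_nonneg hp hq
    have t1 := hterm (d - q) (abs_le.2 ⟨by nlinarith, by nlinarith⟩)
    have t2 := hterm (d + p) (abs_le.2 ⟨by nlinarith, by nlinarith⟩)
    have t3 := hterm d (abs_le.2 ⟨by nlinarith, by nlinarith⟩)
    have t4 := hterm (d + p - q) (abs_le.2 ⟨by nlinarith, by nlinarith⟩)
    have n1 : 0 ≤ |d - q| ^ a := by positivity
    have n2 : 0 ≤ |d + p| ^ a := by positivity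
    have n3 : 0 ≤ |d| ^ a := by positivity
    have n4 : 0 ≤ |d + p - q| ^ a := by positivity
    have hL : |(|d - q| ^ a + |d + p| ^ a - |d| ^ a - |d + p - q| ^ a)| ≤ 4 * M ^ 2 :=
      abs_le.2 ⟨by linarith, by linarith⟩
    have hone : 1 ≤ (2 * (1 + q)) ^ 2 * d ^ (a - 2) := by
      have h1 : 1 ≤ (2 * q / d) ^ (2 - a) :=
        Real.one_le_rpow (by rw [le_div_iff₀ hd]; linarith) (by linarith)
      have h2 : (2 * q / d) ^ (2 - a) = (2 * q) ^ (2 - a) * d ^ (a - 2) := by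
        rw [Real.div_rpow (by linarith) hd.le, div_eq_mul_inv, ← Real.rpow_neg hd.le, neg_sub]
      have h3 : (2 * q) ^ (2 - a) ≤ (2 * (1 + q)) ^ 2 := by
        refine (Real.rpow_le_rpow (by linarith) (by linarith : 2 * q ≤ 2 * (1 + q))
          (by linarith)).trans ?_
        rw [← Real.rpow_natCast]
        exact Real.rpow_le_rpow_of_exponent_le (by linarith) (by push_cast; linarith)
      rw [h2] at h1
      exact h1.trans (mul_le_mul_of_nonneg_right h3 hdpos.le)
    calc _ ≤ 4 * M ^ 2 := hL
      _ ≤ 4 * M ^ 2 * ((2 * (1 + q)) ^ 2 * d ^ (a - 2)) := le_mul_of_one_le_right (by positivity) hone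
      _ = 144 * ((1 + p) ^ 2 * (1 + q) ^ 4) * d ^ (a - 2) := by rw [hM]; ring
      _ ≤ _ := by
        gcongr
        norm_num

/-- The covariance of the increments `B s - B (s - x)` and `B t - B (t - y)` of a fractional
Brownian motion, with the lags `x` and `y` truncated to `[0, s]` and `[0, t]`. -/
noncomputable def incrementCov (H : ℝ) (s t : ℝ≥0) (x y : ℝ) : ℝ :=
  (|(s : ℝ) - (t - y.toNNReal : ℝ≥0)| ^ (2 * H) + |(t : ℝ) - (s - x.toNNReal : ℝ≥0)| ^ (2 * H)
    - |(t : ℝ) - s| ^ (2 * H)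
    - |((t - y.toNNReal : ℝ≥0) : ℝ) - (s - x.toNNReal : ℝ≥0)| ^ (2 * H)) / 2

variable {H : ℝ}

lemma continuous_incrementCov (hH : 0 < H) (s t : ℝ≥0) :
    Continuous (Function.uncurry (incrementCov H s t)) := by
  have hr : Continuous fun z : ℝ ↦ |z| ^ (2 * H) :=
    continuous_abs.rpow_const fun _ ↦ Or.inr (by linarith)
  unfold incrementCov Function.uncurry
  refine Continuous.div_const ?_ 2
  refine Continuous.sub (Continuous.sub (Continuous.add (hr.comp ?_) (hr.comp ?_)) (hr.comp ?_))
    (hr.comp ?_) <;> fun_prop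

lemma abs_incrementCov_le (hH : 0 < H) (s t : ℝ≥0) (x y : ℝ) :
    |incrementCov H s t x y| ≤ 2 * ((s : ℝ) + t) ^ (2 * H) := by
  have hs : ((s - x.toNNReal : ℝ≥0) : ℝ) ≤ s := NNReal.coe_le_coe.2 tsub_le_self
  have ht : ((t - y.toNNReal : ℝ≥0) : ℝ) ≤ t := NNReal.coe_le_coe.2 tsub_le_self
  have hs0 := (s - x.toNNReal : ℝ≥0).coe_nonneg
  have ht0 := (t - y.toNNReal : ℝ≥0).coe_nonneg
  have hterm : ∀ z : ℝ, |z| ≤ s + t → |z| ^ (2 * H) ≤ ((s : ℝ) + t) ^ (2 * H) := fun z hz ↦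
    Real.rpow_le_rpow (abs_nonneg z) hz (by linarith)
  have t1 := hterm ((s : ℝ) - (t - y.toNNReal : ℝ≥0)) (abs_le.2 ⟨by linarith, by linarith⟩)
  have t2 := hterm ((t : ℝ) - (s - x.toNNReal : ℝ≥0)) (abs_le.2 ⟨by linarith, by linarith⟩)
  have t3 := hterm ((t : ℝ) - s) (abs_le.2 ⟨by linarith, by linarith⟩)
  have t4 := hterm (((t - y.toNNReal : ℝ≥0) : ℝ) - (s - x.toNNReal : ℝ≥0))
    (abs_le.2 ⟨by linarith, by linarith⟩)
  have n1 : 0 ≤ |(s : ℝ) - (t - y.toNNReal : ℝ≥0)| ^ (2 * H) := by positivity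
  have n2 : 0 ≤ |(t : ℝ) - (s - x.toNNReal : ℝ≥0)| ^ (2 * H) := by positivity
  have n3 : 0 ≤ |(t : ℝ) - s| ^ (2 * H) := by positivity
  have n4 : 0 ≤ |((t - y.toNNReal : ℝ≥0) : ℝ) - (s - x.toNNReal : ℝ≥0)| ^ (2 * H) := by
    positivity
  unfold incrementCov
  rw [abs_div, abs_two, div_le_iff₀ two_pos]
  exact abs_le.2 ⟨by linarith, by linarith⟩

lemma incrementCov_comm (H : ℝ) (s t : ℝ≥0) (x y : ℝ) :
    incrementCov H t s y x = incrementCov H s t x y := by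
  unfold incrementCov
  rw [abs_sub_comm (s : ℝ) t, abs_sub_comm ((s - x.toNNReal : ℝ≥0) : ℝ)]
  ring

variable {Ω : Type*} [MeasurableSpace Ω] {P : Measure Ω} {B : ℝ≥0 → Ω → ℝ}

lemma IsFractionalBrownianMotion.memLp_two (hB : IsFractionalBrownianMotion H B P) (t : ℝ≥0) :
    MemLp (B t) 2 P := (hB.isGaussianProcess.hasGaussianLaw_eval t).memLp_two

lemma IsFractionalBrownianMotion.covariance_increments [IsProbabilityMeasure P]
    (hB : IsFractionalBrownianMotion H B P) (s t : ℝ≥0) (x y : ℝ) :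
    cov[B s - B (s - x.toNNReal), B t - B (t - y.toNNReal); P] = incrementCov H s t x y := by
  have h := hB.memLp_two
  rw [covariance_sub_left (h _) (h _) ((h _).sub (h _)), covariance_sub_right (h _) (h _) (h _),
    covariance_sub_right (h _) (h _) (h _)]
  simp only [hB.covariance_eq]
  unfold incrementCov
  rw [abs_sub_comm (s : ℝ)]
  ring

end Covariance

section OrnsteinUhlenbeck

variable {Ω : Type*} [MeasurableSpace Ω] {P : Measure Ω} {B X : ℝ≥0 → Ω → ℝ} {H θ : ℝ}

/-- The covariance function of the fractional Ornstein–Uhlenbeck process, as the average of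
increment covariances over two independent exponential lags. -/
noncomputable def ouCov (H θ : ℝ) (s t : ℝ≥0) : ℝ :=
  ∫ x, ∫ y, incrementCov H s t x y ∂expMeasure θ ∂expMeasure θ

lemma integrable_incrementCov_prod (hH : 0 < H) (hθ : 0 < θ) (s t : ℝ≥0) :
    Integrable (Function.uncurry (incrementCov H s t)) ((expMeasure θ).prod (expMeasure θ)) := by
  have := isProbabilityMeasure_expMeasure hθ
  exact Integrable.of_bound (continuous_incrementCov hH s t).aestronglyMeasurable _
    (ae_of_all _ fun z ↦ abs_incrementCov_le hH s t z.1 z.2)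

lemma ouCov_eq_integral_prod (hH : 0 < H) (hθ : 0 < θ) (s t : ℝ≥0) :
    ouCov H θ s t = ∫ z, incrementCov H s t z.1 z.2 ∂(expMeasure θ).prod (expMeasure θ) := by
  have := isProbabilityMeasure_expMeasure hθ
  exact (integral_prod _ (integrable_incrementCov_prod hH hθ s t)).symm

lemma ouCov_comm (hH : 0 < H) (hθ : 0 < θ) (s t : ℝ≥0) : ouCov H θ s t = ouCov H θ t s := by
  have := isProbabilityMeasure_expMeasure hθ
  rw [ouCov, integral_integral_swap (integrable_incrementCov_prod hH hθ s t), ouCov]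
  simp only [incrementCov_comm H t s]

/-- Linear combinations of `X s` and `X t` are integrals, over the lag, of the Gaussian process
`x ↦ a (B s - B (s - x)) + b (B t - B (t - x))`. -/
lemma linear_combination_ou (hθ : 0 < θ) [IsProbabilityMeasure P] (hH : 0 < H)
    (hB : IsFractionalBrownianMotion H B P) (hX : IsOrnsteinUhlenbeckDrivenBy θ X B P)
    (s t : ℝ≥0) (a b : ℝ) :
    HasGaussianLaw (fun ω ↦ a * X s ω + b * X t ω) P ∧ ∫ ω, (a * X s ω + b * X t ω) ∂P = 0 ∧
      Var[fun ω ↦ a * X s ω + b * X t ω; P]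
        = a * a * ouCov H θ s s + 2 * (a * b) * ouCov H θ s t + b * b * ouCov H θ t t := by
  have := isProbabilityMeasure_expMeasure hθ
  set D : ℝ≥0 → ℝ → Ω → ℝ := fun u x ↦ B u - B (u - x.toNNReal) with hD
  set F : ℝ → Ω → ℝ := fun x ↦ a • D s x + b • D t x with hF
  have hL := hB.memLp_two
  have hDL : ∀ u x, MemLp (D u x) 2 P := fun u x ↦ (hL _).sub (hL _)
  have hDi : ∀ u x, Integrable (D u x) P := fun u x ↦ (hDL u x).integrable one_le_two
  have hD0 : ∀ u x, ∫ ω, D u x ω ∂P = 0 := fun u x ↦ by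
    simp only [hD, Pi.sub_apply]
    rw [integral_sub ((hL _).integrable one_le_two) ((hL _).integrable one_le_two),
      hB.centered, hB.centered, sub_zero]
  have hFG : IsGaussianProcess F P := by
    classical
    refine hB.isGaussianProcess.of_isGaussianProcess fun x ↦
      ⟨{s, s - x.toNNReal, t, t - x.toNNReal},
        a • (ContinuousLinearMap.proj ⟨s, by simp⟩
          - ContinuousLinearMap.proj ⟨s - x.toNNReal, by simp⟩)
        + b • (ContinuousLinearMap.proj ⟨t, by simp⟩
          - ContinuousLinearMap.proj ⟨t - x.toNNReal, by simp⟩), fun ω ↦ ?_⟩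
    simp [hF, hD]
  have hF0 : ∀ x, ∫ ω, F x ω ∂P = 0 := fun x ↦ by
    simp only [hF, Pi.add_apply, Pi.smul_apply, smul_eq_mul]
    rw [integral_add ((hDi _ _).const_mul _) ((hDi _ _).const_mul _), integral_const_mul,
      integral_const_mul, hD0, hD0]
    simp
  set K : ℝ → ℝ → ℝ := fun x y ↦ a * a * incrementCov H s s x y
    + a * b * incrementCov H s t x y + b * a * incrementCov H t s x y
    + b * b * incrementCov H t t x y with hKdef
  have hK : ∀ x y, cov[F x, F y; P] = K x y := fun x y ↦ by
    have hc := fun u v ↦ hB.covariance_increments u v x y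
    simp only [hF]
    rw [covariance_add_left ((hDL _ _).const_smul _) ((hDL _ _).const_smul _)
        (((hDL _ _).const_smul _).add ((hDL _ _).const_smul _)),
      covariance_add_right ((hDL _ _).const_smul _) ((hDL _ _).const_smul _)
        ((hDL _ _).const_smul _),
      covariance_add_right ((hDL _ _).const_smul _) ((hDL _ _).const_smul _)
        ((hDL _ _).const_smul _)]
    simp only [covariance_smul_left, covariance_smul_right, hD, hc, hKdef]
    ring
  have cK := fun u v ↦ continuous_incrementCov hH u v
  have hKc : Continuous (Function.uncurry K) :=
    ((((cK s s).const_mul (a * a)).add ((cK s t).const_mul (a * b))).add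
      ((cK t s).const_mul (b * a))).add ((cK t t).const_mul (b * b))
  obtain ⟨C, hC⟩ : ∃ C, ∀ x y, |K x y| ≤ C := by
    refine ⟨|a * a| * (2 * ((s : ℝ) + s) ^ (2 * H)) + |a * b| * (2 * ((s : ℝ) + t) ^ (2 * H))
      + |b * a| * (2 * ((t : ℝ) + s) ^ (2 * H)) + |b * b| * (2 * ((t : ℝ) + t) ^ (2 * H)),
      fun x y ↦ ?_⟩
    have hb := fun (c : ℝ) (u v : ℝ≥0) ↦ (abs_mul c (incrementCov H u v x y)).trans_le
      (mul_le_mul_of_nonneg_left (abs_incrementCov_le hH u v x y) (abs_nonneg c))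
    exact (abs_add_le _ _).trans (add_le_add ((abs_add_le _ _).trans (add_le_add
      ((abs_add_le _ _).trans (add_le_add (hb _ s s) (hb _ s t))) (hb _ t s))) (hb _ t t))
  have hDb : ∀ ω, Continuous (fun u ↦ B u ω) → ∀ u : ℝ≥0, ∃ M, ∀ x, |D u x ω| ≤ M := by
    intro ω hc u
    obtain ⟨M, hM⟩ := (isCompact_Icc (a := (0 : ℝ≥0)) (b := u)).exists_bound_of_continuousOn
      hc.continuousOn
    refine ⟨M + M, fun x ↦ (abs_sub _ _).trans (add_le_add ?_ ?_)⟩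
    · exact hM _ ⟨zero_le, le_rfl⟩
    · exact hM _ ⟨zero_le, tsub_le_self⟩
  have hFc : ∀ᵐ ω ∂P, Continuous fun x ↦ F x ω := by
    filter_upwards [hB.continuous_paths] with ω hω
    simp only [hF, hD, Pi.add_apply, Pi.smul_apply, Pi.sub_apply]
    fun_prop
  have hFb : ∀ᵐ ω ∂P, ∃ M, ∀ x, |F x ω| ≤ M := by
    filter_upwards [hB.continuous_paths] with ω hω
    obtain ⟨M₁, h₁⟩ := hDb ω hω s
    obtain ⟨M₂, h₂⟩ := hDb ω hω t
    refine ⟨|a| * M₁ + |b| * M₂, fun x ↦ (abs_add_le _ _).trans (add_le_add ?_ ?_)⟩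
    · simp only [Pi.smul_apply, smul_eq_mul, abs_mul]
      exact mul_le_mul_of_nonneg_left (h₁ x) (abs_nonneg a)
    · simp only [Pi.smul_apply, smul_eq_mul, abs_mul]
      exact mul_le_mul_of_nonneg_left (h₂ x) (abs_nonneg b)
  have hZ : ∀ᵐ ω ∂P, a * X s ω + b * X t ω = ∫ x, F x ω ∂expMeasure θ := by
    filter_upwards [hB.continuous_paths, hX] with ω hω ⟨hx0, hxc, hxe⟩
    have hi : ∀ u, Integrable (fun x ↦ D u x ω) (expMeasure θ) := fun u ↦ by
      obtain ⟨M, hM⟩ := hDb ω hω u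
      refine Integrable.of_bound (Continuous.aestronglyMeasurable ?_) M (ae_of_all _ hM)
      simp only [hD, Pi.sub_apply]
      fun_prop
    have hsol : ∀ u, X u ω = ∫ x, D u x ω ∂expMeasure θ := fun u ↦
      eq_integral_increment_expMeasure hθ hx0 hxc hω hxe u
    rw [hsol, hsol]
    simp only [hF, Pi.add_apply, Pi.smul_apply, smul_eq_mul]
    rw [integral_add ((hi s).const_mul a) ((hi t).const_mul b), integral_const_mul,
      integral_const_mul]
  obtain ⟨h1, h2, h3⟩ := map_integral_gaussianProcess (expMeasure θ) hFG hF0 hK hKc hC hFc hFb hZ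
  refine ⟨h1, h2, h3.trans ?_⟩
  have ip := fun u v ↦ integrable_incrementCov_prod hH hθ u v
  have e : ∫ x, ∫ y, K x y ∂expMeasure θ ∂expMeasure θ
      = ∫ z, Function.uncurry K z ∂(expMeasure θ).prod (expMeasure θ) := by
    refine (integral_prod (μ := expMeasure θ) (ν := expMeasure θ) (Function.uncurry K) ?_).symm
    exact ((((ip s s).const_mul (a * a)).add ((ip s t).const_mul (a * b))).add
      ((ip t s).const_mul (b * a))).add ((ip t t).const_mul (b * b))
  have e2 : ∫ z, Function.uncurry K z ∂(expMeasure θ).prod (expMeasure θ)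
      = a * a * ouCov H θ s s + a * b * ouCov H θ s t + b * a * ouCov H θ t s
        + b * b * ouCov H θ t t := by
    simp only [ouCov_eq_integral_prod hH hθ, ← integral_const_mul]
    rw [← integral_add, ← integral_add, ← integral_add]
    · rfl
    · exact (((ip s s).const_mul (a * a)).add ((ip s t).const_mul (a * b))).add
        ((ip t s).const_mul (b * a))
    · exact (ip t t).const_mul (b * b)
    · exact ((ip s s).const_mul (a * a)).add ((ip s t).const_mul (a * b))
    · exact (ip t s).const_mul (b * a)
    · exact (ip s s).const_mul (a * a)
    · exact (ip s t).const_mul (a * b)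
  rw [e, e2, ouCov_comm hH hθ t s]
  ring

/-- The fractional Ornstein–Uhlenbeck process is centred Gaussian with covariance `ouCov`. -/
lemma gaussian_pair_ou (hθ : 0 < θ) [IsProbabilityMeasure P] (hH : 0 < H)
    (hB : IsFractionalBrownianMotion H B P) (hX : IsOrnsteinUhlenbeckDrivenBy θ X B P)
    (s t : ℝ≥0) :
    HasGaussianLaw (fun ω ↦ (X s ω, X t ω)) P ∧ ∫ ω, X s ω ∂P = 0 ∧
      cov[X s, X t; P] = ouCov H θ s t := by
  have h := linear_combination_ou hθ hH hB hX s t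
  have hp := hasGaussianLaw_prodMk_of_linear_combinations fun a b ↦ (h a b).1
  refine ⟨hp, by simpa using (h 1 0).2.1, ?_⟩
  -- polarisation of the variance
  have v1 := (h 1 0).2.2
  have v2 := (h 0 1).2.2
  have v3 := (h 1 1).2.2
  simp only [one_mul, zero_mul, mul_one, add_zero, zero_add, mul_zero] at v1 v2 v3
  rw [variance_fun_add hp.fst.memLp_two hp.snd.memLp_two] at v3
  have v1' : Var[X s; P] = ouCov H θ s s := v1
  have v2' : Var[X t; P] = ouCov H θ t t := v2
  have v3' : Var[X s; P] + 2 * cov[X s, X t; P] + Var[X t; P]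
    = ouCov H θ s s + 2 * ouCov H θ s t + ouCov H θ t t := v3
  linarith

lemma coe_sub_coe_tsub_toNNReal_le (u : ℝ≥0) (x : ℝ) :
    (u : ℝ) - (u - x.toNNReal : ℝ≥0) ≤ |x| := by
  have h1 : (u : ℝ) ≤ (u - x.toNNReal : ℝ≥0) + x.toNNReal := by
    exact_mod_cast le_tsub_add (a := x.toNNReal) (b := u)
  have h2 : (x.toNNReal : ℝ) ≤ |x| := by
    rw [Real.coe_toNNReal']; exact max_le (le_abs_self x) (abs_nonneg x)
  linarith

/-- Polynomial decay of the correlations, uniform in the starting time. -/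
lemma abs_ouCov_le (hθ : 0 < θ) (hH : H ∈ Set.Ioo (0 : ℝ) 1) :
    ∃ C, ∀ s t : ℝ≥0, s < t → |ouCov H θ s t| ≤ C * ((t : ℝ) - s) ^ (2 * H - 2) := by
  have := isProbabilityMeasure_expMeasure hθ
  have hi := (integrable_one_add_pow_expMeasure hθ 4)
  refine ⟨∫ z : ℝ × ℝ, 72 * ((1 + |z.1|) ^ 4 * (1 + |z.2|) ^ 4)
    ∂(expMeasure θ).prod (expMeasure θ), fun s t hst ↦ ?_⟩
  have hd : (0 : ℝ) < t - s := sub_pos.2 (NNReal.coe_lt_coe.2 hst)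
  rw [ouCov_eq_integral_prod hH.1 hθ, ← integral_mul_const]
  refine (abs_integral_le_integral_abs).trans (integral_mono
    (integrable_incrementCov_prod hH.1 hθ s t).abs
    (((hi.mul_prod hi).const_mul 72).mul_const _) fun z ↦ ?_)
  have hs : ((s - z.1.toNNReal : ℝ≥0) : ℝ) ≤ s := NNReal.coe_le_coe.2 tsub_le_self
  have ht : ((t - z.2.toNNReal : ℝ≥0) : ℝ) ≤ t := NNReal.coe_le_coe.2 tsub_le_self
  have h := abs_second_difference_rpow_le (a := 2 * H) (by linarith [hH.1]) (by linarith [hH.2])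
    hd (sub_nonneg.2 hs) (sub_nonneg.2 ht)
  have e : incrementCov H s t z.1 z.2 = (|(t : ℝ) - s - (t - (t - z.2.toNNReal : ℝ≥0))| ^ (2 * H)
      + |(t : ℝ) - s + (s - (s - z.1.toNNReal : ℝ≥0))| ^ (2 * H) - |(t : ℝ) - s| ^ (2 * H)
      - |(t : ℝ) - s + (s - (s - z.1.toNNReal : ℝ≥0)) - (t - (t - z.2.toNNReal : ℝ≥0))|
        ^ (2 * H)) / 2 := by
    unfold incrementCov
    rw [abs_sub_comm (s : ℝ)]
    ring_nf
  simp only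
  rw [e, abs_div, abs_two, div_le_iff₀ two_pos]
  refine h.trans ?_
  have l1 := coe_sub_coe_tsub_toNNReal_le s z.1
  have l2 := coe_sub_coe_tsub_toNNReal_le t z.2
  have p1 := sub_nonneg.2 hs
  have p2 := sub_nonneg.2 ht
  have hdp : 0 < ((t : ℝ) - s) ^ (2 * H - 2) := by positivity
  calc _ ≤ 144 * ((1 + |z.1|) ^ 4 * (1 + |z.2|) ^ 4) * ((t : ℝ) - s) ^ (2 * H - 2) := by gcongr
    _ = _ := by ring

/-- The stationary variance: `Var X_t → H Γ(2H) θ ^ (-2H)`. -/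
lemma tendsto_ouCov_self (hθ : 0 < θ) (hH : H ∈ Set.Ioo (0 : ℝ) 1) :
    Tendsto (fun k : ℕ ↦ ouCov H θ k k) atTop
      (𝓝 (H * Real.Gamma (2 * H) * θ ^ (-2 * H))) := by
  have := isProbabilityMeasure_expMeasure hθ
  have h2H : 0 < 2 * H := by linarith [hH.1]
  set L : ℝ × ℝ → ℝ := fun z ↦ (z.2 ^ (2 * H) + z.1 ^ (2 * H) - |z.1 - z.2| ^ (2 * H)) / 2
    with hL
  have hpos : ∀ᵐ z ∂(expMeasure θ).prod (expMeasure θ), 0 < z.1 ∧ 0 < z.2 :=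
    (Measure.quasiMeasurePreserving_fst.ae (ae_expMeasure_pos θ)).and
      (Measure.quasiMeasurePreserving_snd.ae (ae_expMeasure_pos θ))
  have hi := integrable_one_add_pow_expMeasure hθ 2
  have habsb : ∀ (z : ℝ × ℝ) (w : ℝ), |w| ≤ |z.1| + |z.2| →
      |w| ^ (2 * H) ≤ (1 + |z.1|) ^ 2 * (1 + |z.2|) ^ 2 := fun z w hw ↦ by
    have h1 : |w| ≤ (1 + |z.1|) * (1 + |z.2|) := by
      nlinarith [abs_nonneg z.1, abs_nonneg z.2]
    have h3 : 1 ≤ (1 + |z.1|) * (1 + |z.2|) := by nlinarith [abs_nonneg z.1, abs_nonneg z.2]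
    refine (Real.rpow_le_rpow (abs_nonneg _) h1 h2H.le).trans ?_
    rw [← mul_pow, ← Real.rpow_natCast]
    exact Real.rpow_le_rpow_of_exponent_le h3 (by push_cast; linarith [hH.2])
  have hlim : ∫ z, L z ∂(expMeasure θ).prod (expMeasure θ)
      = H * Real.Gamma (2 * H) * θ ^ (-2 * H) := by
    have i1 : Integrable (fun z : ℝ × ℝ ↦ z.1 ^ (2 * H)) ((expMeasure θ).prod (expMeasure θ)) :=
      (integrable_rpow_expMeasure hθ h2H.le).comp_fst _
    have i2 : Integrable (fun z : ℝ × ℝ ↦ z.2 ^ (2 * H)) ((expMeasure θ).prod (expMeasure θ)) :=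
      (integrable_rpow_expMeasure hθ h2H.le).comp_snd _
    have i3 : Integrable (fun z : ℝ × ℝ ↦ |z.1 - z.2| ^ (2 * H))
        ((expMeasure θ).prod (expMeasure θ)) := by
      refine (hi.mul_prod hi).mono' (Measurable.aestronglyMeasurable (by fun_prop))
        (ae_of_all _ fun z ↦ ?_)
      rw [Real.norm_of_nonneg (by positivity)]
      exact habsb z _ (abs_sub _ _)
    simp only [hL]
    rw [integral_div, integral_sub (f := fun z : ℝ × ℝ ↦ z.2 ^ (2 * H) + z.1 ^ (2 * H)) (i2.add i1) i3, integral_add i2 i1,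
      integral_prod _ i3, integral_integral_abs_sub_rpow_expMeasure hθ h2H,
      integral_fun_fst (fun x : ℝ ↦ x ^ (2 * H)), integral_fun_snd (fun x : ℝ ↦ x ^ (2 * H)),
      integral_rpow_expMeasure hθ h2H.le, Real.Gamma_add_one h2H.ne', probReal_univ]
    simp only [one_smul, neg_mul]
    ring
  rw [← hlim]
  simp_rw [ouCov_eq_integral_prod hH.1 hθ]
  refine tendsto_integral_filter_of_dominated_convergence
    (fun z : ℝ × ℝ ↦ 2 * ((1 + |z.1|) ^ 2 * (1 + |z.2|) ^ 2)) (Eventually.of_forall fun k ↦ ?_)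
    (Eventually.of_forall fun k ↦ ?_) ((hi.mul_prod hi).const_mul 2) ?_
  · exact (continuous_incrementCov hH.1 k k).aestronglyMeasurable
  · refine ae_of_all _ fun z ↦ ?_
    have l1 := coe_sub_coe_tsub_toNNReal_le k z.1
    have l2 := coe_sub_coe_tsub_toNNReal_le k z.2
    have hs : (((k : ℝ≥0) - z.1.toNNReal : ℝ≥0) : ℝ) ≤ (k : ℝ≥0) := NNReal.coe_le_coe.2 tsub_le_self
    have ht : (((k : ℝ≥0) - z.2.toNNReal : ℝ≥0) : ℝ) ≤ (k : ℝ≥0) := NNReal.coe_le_coe.2 tsub_le_self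
    have a1 := abs_nonneg z.1
    have a2 := abs_nonneg z.2
    have t1 := habsb z (((k : ℝ≥0) : ℝ) - ((k : ℝ≥0) - z.2.toNNReal : ℝ≥0))
      (abs_le.2 ⟨by linarith, by linarith⟩)
    have t2 := habsb z (((k : ℝ≥0) : ℝ) - ((k : ℝ≥0) - z.1.toNNReal : ℝ≥0))
      (abs_le.2 ⟨by linarith, by linarith⟩)
    have t3 := habsb z ((((k : ℝ≥0) - z.2.toNNReal : ℝ≥0) : ℝ) - ((k : ℝ≥0) - z.1.toNNReal : ℝ≥0))
      (abs_le.2 ⟨by linarith, by linarith⟩)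
    have n1 := Real.rpow_nonneg (abs_nonneg
      (((k : ℝ≥0) : ℝ) - ((k : ℝ≥0) - z.2.toNNReal : ℝ≥0))) (2 * H)
    have n2 := Real.rpow_nonneg (abs_nonneg
      (((k : ℝ≥0) : ℝ) - ((k : ℝ≥0) - z.1.toNNReal : ℝ≥0))) (2 * H)
    have n3 := Real.rpow_nonneg (abs_nonneg
      ((((k : ℝ≥0) - z.2.toNNReal : ℝ≥0) : ℝ) - ((k : ℝ≥0) - z.1.toNNReal : ℝ≥0))) (2 * H)
    simp only [incrementCov, sub_self, abs_zero, Real.zero_rpow h2H.ne', sub_zero]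
    rw [Real.norm_eq_abs, abs_div, abs_two, div_le_iff₀ two_pos]
    exact abs_le.2 ⟨by linarith, by linarith⟩
  · filter_upwards [hpos] with z ⟨h1, h2⟩
    refine tendsto_const_nhds.congr' ?_
    obtain ⟨n, hn⟩ := exists_nat_ge (max z.1 z.2)
    filter_upwards [eventually_ge_atTop n] with k hk
    have hk' : (n : ℝ) ≤ k := by exact_mod_cast hk
    have c1 : (((k : ℝ≥0) - z.1.toNNReal : ℝ≥0) : ℝ) = k - z.1 := by
      rw [NNReal.coe_sub (Real.toNNReal_le_iff_le_coe.2 (by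
        simpa using (le_max_left _ _).trans (hn.trans hk'))), Real.coe_toNNReal _ h1.le]
      simp
    have c2 : (((k : ℝ≥0) - z.2.toNNReal : ℝ≥0) : ℝ) = k - z.2 := by
      rw [NNReal.coe_sub (Real.toNNReal_le_iff_le_coe.2 (by
        simpa using (le_max_right _ _).trans (hn.trans hk'))), Real.coe_toNNReal _ h2.le]
      simp
    simp only [hL, incrementCov, c1, c2, NNReal.coe_natCast, sub_sub_cancel, sub_self, abs_zero,
      Real.zero_rpow h2H.ne', sub_zero, abs_of_pos h1, abs_of_pos h2]
    congr 4
    ring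

end OrnsteinUhlenbeck

/-! ### A strong law for weakly correlated variables -/

section StrongLaw

variable {Ω : Type*} [MeasurableSpace Ω] {P : Measure Ω}

lemma ae_tendsto_zero_of_summable_integral_sq {W : ℕ → Ω → ℝ} (hW : ∀ k, MemLp (W k) 2 P)
    (hs : Summable fun k ↦ ∫ ω, W k ω ^ 2 ∂P) :
    ∀ᵐ ω ∂P, Tendsto (fun k ↦ W k ω) atTop (𝓝 0) := by
  have hm : ∀ k, AEMeasurable (fun ω ↦ ENNReal.ofReal (W k ω ^ 2)) P := fun k ↦
    ((hW k).aestronglyMeasurable.aemeasurable.pow_const 2).ennreal_ofReal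
  have hfin : ∫⁻ ω, ∑' k, ENNReal.ofReal (W k ω ^ 2) ∂P ≠ ⊤ := by
    rw [lintegral_tsum hm]
    have e : ∀ k, ∫⁻ ω, ENNReal.ofReal (W k ω ^ 2) ∂P = ENNReal.ofReal (∫ ω, W k ω ^ 2 ∂P) :=
      fun k ↦ (ofReal_integral_eq_lintegral_ofReal (hW k).integrable_sq
        (ae_of_all _ fun ω ↦ sq_nonneg _)).symm
    simp_rw [e]
    exact hs.tsum_ofReal_ne_top
  filter_upwards [ae_lt_top' (AEMeasurable.tsum hm) hfin] with ω hω
  have h1 := ENNReal.tendsto_atTop_zero_of_tsum_ne_top hω.ne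
  have h2 : Tendsto (fun k ↦ W k ω ^ 2) atTop (𝓝 0) := by
    have := (ENNReal.tendsto_toReal ENNReal.zero_ne_top).comp h1
    refine (this.congr fun k ↦ ?_)
    simp [ENNReal.toReal_ofReal (sq_nonneg _)]
  have h3 := (Real.continuous_sqrt.tendsto 0).comp h2
  rw [Real.sqrt_zero] at h3
  refine (tendsto_zero_iff_abs_tendsto_zero _).2 (h3.congr fun k ↦ ?_)
  simp [Real.sqrt_sq_eq_abs]

lemma sum_range_succ_rpow_neg_le {κ : ℝ} (h0 : 0 < κ) (h1 : κ < 1) (n : ℕ) :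
    ∑ d ∈ Finset.range n, ((d : ℝ) + 1) ^ (-κ) ≤ (n : ℝ) ^ (1 - κ) / (1 - κ) := by
  have h1' : 0 < 1 - κ := by linarith
  induction n with
  | zero => simp [Real.zero_rpow h1'.ne']
  | succ n ih =>
    rw [Finset.sum_range_succ, le_div_iff₀ h1', add_mul]
    rw [le_div_iff₀ h1'] at ih
    push_cast
    have hn : (0 : ℝ) < (n : ℝ) + 1 := by positivity
    -- Bernoulli's inequality for the exponent `1 - κ` at `1 - 1 / (n + 1)`
    have hb := rpow_one_add_le_one_add_mul_self (s := -(1 / ((n : ℝ) + 1))) (p := 1 - κ)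
      (by rw [neg_le_neg_iff, div_le_one hn]; linarith [n.cast_nonneg (α := ℝ)]) h1'.le
      (by linarith)
    have e1 : 1 + -(1 / ((n : ℝ) + 1)) = n / (n + 1) := by field_simp; ring
    rw [e1, Real.div_rpow n.cast_nonneg hn.le, div_le_iff₀ (by positivity)] at hb
    have e2 : ((n : ℝ) + 1) ^ (1 - κ) = (n + 1) * ((n : ℝ) + 1) ^ (-κ) := by
      rw [sub_eq_add_neg, Real.rpow_add hn, Real.rpow_one]
    have e3 : (1 + (1 - κ) * -(1 / ((n : ℝ) + 1))) * ((n : ℝ) + 1) ^ (1 - κ)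
        = ((n : ℝ) + 1) ^ (1 - κ) - (1 - κ) * ((n : ℝ) + 1) ^ (-κ) := by
      rw [e2]; field_simp; ring
    rw [e3] at hb
    linarith

lemma variance_sum_range_le [IsProbabilityMeasure P] {Z : ℕ → Ω → ℝ} {κ C : ℝ} (h0 : 0 < κ)
    (h1 : κ < 1) (hC : 0 ≤ C) (hZ : ∀ k, MemLp (Z k) 2 P)
    (hcov : ∀ j k, j ≤ k → |cov[Z j, Z k; P]| ≤ C * ((k - j : ℕ) + 1 : ℝ) ^ (-κ)) (n : ℕ) :
    Var[∑ k ∈ Finset.range n, Z k; P] ≤ 2 * C / (1 - κ) * (n * (n : ℝ) ^ (1 - κ)) := by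
  have h1' : 0 < 1 - κ := by linarith
  induction n with
  | zero => simp
  | succ n ih =>
    have hS : MemLp (∑ k ∈ Finset.range n, Z k) 2 P := memLp_finsetSum' _ fun k _ ↦ hZ k
    rw [Finset.sum_range_succ, variance_add hS (hZ n), covariance_sum_left' (fun k _ ↦ hZ k) (hZ n),
      ← covariance_self (hZ n).aestronglyMeasurable.aemeasurable]
    have hA : 2 * ∑ k ∈ Finset.range n, cov[Z k, Z n; P] + cov[Z n, Z n; P]
        ≤ 2 * (C * (((n + 1 : ℕ) : ℝ) ^ (1 - κ) / (1 - κ))) := by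
      have hn0 : 0 ≤ C * (((n - n : ℕ) : ℝ) + 1) ^ (-κ) := by positivity
      calc 2 * ∑ k ∈ Finset.range n, cov[Z k, Z n; P] + cov[Z n, Z n; P]
          ≤ 2 * ∑ k ∈ Finset.range n, C * ((n - k : ℕ) + 1 : ℝ) ^ (-κ)
              + 2 * (C * ((n - n : ℕ) + 1 : ℝ) ^ (-κ)) := by
            gcongr with k hk
            · exact (le_abs_self _).trans (hcov k n (Finset.mem_range.1 hk).le)
            · exact ((le_abs_self _).trans (hcov n n le_rfl)).trans (by linarith)
        _ = 2 * ∑ k ∈ Finset.range (n + 1), C * ((n - k : ℕ) + 1 : ℝ) ^ (-κ) := by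
            rw [Finset.sum_range_succ]; ring
        _ = 2 * (C * ∑ d ∈ Finset.range (n + 1), ((d : ℝ) + 1) ^ (-κ)) := by
            rw [← Finset.mul_sum, ← Finset.sum_range_reflect (fun d ↦ ((d : ℝ) + 1) ^ (-κ))]
            simp only [Nat.add_sub_cancel]
        _ ≤ _ := by
            gcongr
            exact sum_range_succ_rpow_neg_le h0 h1 (n + 1)
    have hB : (n : ℝ) * (n : ℝ) ^ (1 - κ) ≤ n * ((n + 1 : ℕ) : ℝ) ^ (1 - κ) := by
      gcongr
      simp
    have hC' : 0 ≤ 2 * C / (1 - κ) := by positivity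
    have hD := mul_le_mul_of_nonneg_left hB hC'
    have e : 2 * (C * (((n + 1 : ℕ) : ℝ) ^ (1 - κ) / (1 - κ)))
        = 2 * C / (1 - κ) * ((n + 1 : ℕ) : ℝ) ^ (1 - κ) := by ring
    rw [e] at hA
    have e' : 2 * C / (1 - κ) * (((n + 1 : ℕ) : ℝ) * ((n + 1 : ℕ) : ℝ) ^ (1 - κ))
        = 2 * C / (1 - κ) * (n * ((n + 1 : ℕ) : ℝ) ^ (1 - κ))
          + 2 * C / (1 - κ) * ((n + 1 : ℕ) : ℝ) ^ (1 - κ) := by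
      push_cast; ring
    rw [e']
    linarith

lemma summable_floor_pow_rpow_neg {a κ : ℝ} (ha : 1 < a) (h0 : 0 < κ) :
    Summable fun k : ℕ ↦ ((⌊a ^ k⌋₊ : ℕ) : ℝ) ^ (-κ) := by
  have ha0 : 0 < a := by linarith
  have hg : Summable fun k : ℕ ↦ (2 : ℝ) ^ κ * (a ^ (-κ)) ^ k :=
    (summable_geometric_of_lt_one (by positivity)
      (Real.rpow_lt_one_of_one_lt_of_neg ha (by linarith))).mul_left _
  refine hg.of_nonneg_of_le (fun k ↦ by positivity) fun k ↦ ?_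
  have h1 : 1 ≤ a ^ k := one_le_pow₀ ha.le
  have h2 : (1 : ℝ) ≤ (⌊a ^ k⌋₊ : ℕ) := by
    exact_mod_cast (Nat.one_le_floor_iff (a ^ k)).2 h1
  have h3 := Nat.lt_floor_add_one (a ^ k)
  have h4 : a ^ k / 2 ≤ (⌊a ^ k⌋₊ : ℕ) := by linarith
  calc ((⌊a ^ k⌋₊ : ℕ) : ℝ) ^ (-κ) ≤ (a ^ k / 2) ^ (-κ) :=
        Real.rpow_le_rpow_of_nonpos (by positivity) h4 (by linarith)
    _ = 2 ^ κ * (a ^ (-κ)) ^ k := by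
      rw [Real.div_rpow (by positivity) two_pos.le, Real.rpow_neg two_pos.le, div_inv_eq_mul,
        mul_comm, ← Real.rpow_natCast, ← Real.rpow_natCast, ← Real.rpow_mul ha0.le,
        ← Real.rpow_mul ha0.le, mul_comm (k : ℝ)]

/-- A strong law of large numbers for variables bounded below whose covariances decay polynomially.
Chebyshev bounds along geometric subsequences suffice, since the partial sums are monotone after
adding a constant. -/
theorem ae_tendsto_sum_div_of_covariance_le [IsProbabilityMeasure P] {Z : ℕ → Ω → ℝ}
    {κ C c m : ℝ} (h0 : 0 < κ) (h1 : κ < 1) (hC : 0 ≤ C) (hZ : ∀ k, MemLp (Z k) 2 P)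
    (hcov : ∀ j k, j ≤ k → |cov[Z j, Z k; P]| ≤ C * ((k - j : ℕ) + 1 : ℝ) ^ (-κ))
    (hc : ∀ k ω, -c ≤ Z k ω) (hm : Tendsto (fun k ↦ ∫ ω, Z k ω ∂P) atTop (𝓝 m)) :
    ∀ᵐ ω ∂P, Tendsto (fun n : ℕ ↦ (∑ k ∈ Finset.range n, Z k ω) / n) atTop (𝓝 m) := by
  have h1' : 0 < 1 - κ := by linarith
  set S : ℕ → Ω → ℝ := fun n ↦ ∑ k ∈ Finset.range n, Z k with hS
  have hSL : ∀ n, MemLp (S n) 2 P := fun n ↦ memLp_finsetSum' _ fun k _ ↦ hZ k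
  have hSE : ∀ n, ∫ ω, S n ω ∂P = ∑ k ∈ Finset.range n, ∫ ω, Z k ω ∂P := fun n ↦ by
    simp only [hS, Finset.sum_apply]
    exact integral_finsetSum _ fun k _ ↦ (hZ k).integrable one_le_two
  have hmean : Tendsto (fun n : ℕ ↦ (∫ ω, S n ω ∂P) / n) atTop (𝓝 m) := by
    refine hm.cesaro.congr fun n ↦ ?_
    rw [hSE, div_eq_inv_mul]
  have hsub : ∀ a : ℝ, 1 < a → ∀ᵐ ω ∂P,
      Tendsto (fun k : ℕ ↦ S ⌊a ^ k⌋₊ ω / (⌊a ^ k⌋₊ : ℕ)) atTop (𝓝 m) := fun a ha ↦ by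
    have hfl : Tendsto (fun k : ℕ ↦ ⌊a ^ k⌋₊) atTop atTop :=
      tendsto_nat_floor_atTop.comp (tendsto_pow_atTop_atTop_of_one_lt ha)
    set W : ℕ → Ω → ℝ := fun k ω ↦
      (S ⌊a ^ k⌋₊ ω - ∫ ω', S ⌊a ^ k⌋₊ ω' ∂P) / (⌊a ^ k⌋₊ : ℕ) with hW
    have hWL : ∀ k, MemLp (W k) 2 P := fun k ↦ by
      simp only [hW, div_eq_mul_inv]
      exact ((hSL _).sub (memLp_const _)).mul_const _
    have hWb : ∀ k, ∫ ω, W k ω ^ 2 ∂P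
        ≤ 2 * C / (1 - κ) * ((⌊a ^ k⌋₊ : ℕ) : ℝ) ^ (-κ) := fun k ↦ by
      set N := ⌊a ^ k⌋₊ with hN
      have hN0 : (0 : ℝ) < N := by
        have : 1 ≤ N := (Nat.one_le_floor_iff (a ^ k)).2 (one_le_pow₀ ha.le)
        exact_mod_cast this
      have hv := variance_sum_range_le h0 h1 hC hZ hcov N
      rw [variance_eq_integral (hSL N).aestronglyMeasurable.aemeasurable] at hv
      simp only [hW, div_pow]
      rw [integral_div, div_le_iff₀ (by positivity)]
      refine hv.trans (le_of_eq ?_)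
      rw [sub_eq_add_neg, Real.rpow_add hN0, Real.rpow_one]
      ring
    have hWs : Summable fun k ↦ ∫ ω, W k ω ^ 2 ∂P :=
      ((summable_floor_pow_rpow_neg ha h0).mul_left _).of_nonneg_of_le
        (fun k ↦ integral_nonneg fun ω ↦ sq_nonneg _) hWb
    filter_upwards [ae_tendsto_zero_of_summable_integral_sq hWL hWs] with ω hω
    have := hω.add (hmean.comp hfl)
    rw [zero_add] at this
    refine this.congr fun k ↦ ?_
    simp only [hW, Function.comp_apply]
    ring
  have hall : ∀ᵐ ω ∂P, ∀ i : ℕ, Tendsto (fun k : ℕ ↦ S ⌊(1 + 1 / ((i : ℝ) + 1)) ^ k⌋₊ ω /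
      (⌊(1 + 1 / ((i : ℝ) + 1)) ^ k⌋₊ : ℕ)) atTop (𝓝 m) :=
    ae_all_iff.2 fun i ↦ hsub _ (by
      have : (0 : ℝ) < 1 / ((i : ℝ) + 1) := by positivity
      linarith)
  filter_upwards [hall] with ω hω
  -- the partial sums of the nonnegative variables `Z k + c` are monotone
  have key := tendsto_div_of_monotone_of_tendsto_div_floor_pow
    (fun n ↦ ∑ k ∈ Finset.range n, (Z k ω + c)) (m + c)
    (monotone_nat_of_le_succ fun n ↦ by
      rw [Finset.sum_range_succ]
      linarith [hc n ω])
    (fun i : ℕ ↦ 1 + 1 / ((i : ℝ) + 1))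
    (fun i ↦ by
      have : (0 : ℝ) < 1 / ((i : ℝ) + 1) := by positivity
      linarith)
    (by simpa using (tendsto_one_div_add_atTop_nhds_zero_nat (𝕜 := ℝ)).const_add 1)
    (fun i ↦ by
      have hi1 : 1 < 1 + 1 / ((i : ℝ) + 1) := by
        have : (0 : ℝ) < 1 / ((i : ℝ) + 1) := by positivity
        linarith
      refine ((hω i).add_const c).congr fun k ↦ ?_
      have hN : ((⌊(1 + 1 / ((i : ℝ) + 1)) ^ k⌋₊ : ℕ) : ℝ) ≠ 0 := by
        have : 1 ≤ ⌊(1 + 1 / ((i : ℝ) + 1)) ^ k⌋₊ :=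
          (Nat.one_le_floor_iff _).2 (one_le_pow₀ hi1.le)
        exact_mod_cast (by omega : ⌊(1 + 1 / ((i : ℝ) + 1)) ^ k⌋₊ ≠ 0)
      simp only [hS, Finset.sum_apply, Finset.sum_add_distrib, Finset.sum_const,
        Finset.card_range, nsmul_eq_mul]
      rw [add_div, mul_div_cancel_left₀ _ hN])
  have h2 := key.sub_const c
  rw [add_sub_cancel_right] at h2
  refine h2.congr' ?_
  filter_upwards [eventually_gt_atTop 0] with n hn
  have hn' : (n : ℝ) ≠ 0 := by exact_mod_cast hn.ne'
  simp only [Finset.sum_add_distrib, Finset.sum_const, Finset.card_range, nsmul_eq_mul]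
  field_simp
  ring

end StrongLaw

/-! ### The function `μ_q` and its inverse -/

section MuFun

variable {H : ℝ} {q : ℕ}

lemma mul_Gamma_two_mul_pos (hH : 0 < H) : 0 < H * Real.Gamma (2 * H) :=
  mul_pos hH (Real.Gamma_pos_of_pos (by linarith))

lemma strictAntiOn_muFun_base (hH : 0 < H) :
    StrictAntiOn (fun ϑ : ℝ ↦ H * Real.Gamma (2 * H) * ϑ ^ (-2 * H) - 1) (Set.Ioi 0) := by
  intro x hx y _ hxy
  have h := Real.rpow_lt_rpow_of_neg (z := -2 * H) hx hxy (by linarith)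
  exact sub_lt_sub_right (mul_lt_mul_of_pos_left h (mul_Gamma_two_mul_pos hH)) 1

lemma muFun_coeff_pos (q : ℕ) :
    0 < (q.factorial : ℝ) / (((q / 2).factorial : ℝ) * 2 ^ (q / 2)) := by positivity

lemma injOn_muFun_of_odd (hH : 0 < H) (hq : Odd (q / 2)) :
    Set.InjOn (muFun H q) (Set.Ioi 0) := by
  intro x hx y hy hxy
  have h := mul_left_cancel₀ (muFun_coeff_pos q).ne' hxy
  exact (strictAntiOn_muFun_base hH).injOn hx hy (hq.strictMono_pow.injective h)

/-- `μ_q` is injective wherever the base `H Γ(2H) ϑ ^ (-2H) - 1` of its power has constant sign,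
whatever the parity of `q / 2`. -/
lemma injOn_muFun_of_sign (hH : 0 < H) (hq : q / 2 ≠ 0) {s : Set ℝ} (hs : s ⊆ Set.Ioi 0)
    (h : (∀ ϑ ∈ s, 0 ≤ H * Real.Gamma (2 * H) * ϑ ^ (-2 * H) - 1) ∨
      ∀ ϑ ∈ s, H * Real.Gamma (2 * H) * ϑ ^ (-2 * H) - 1 ≤ 0) :
    Set.InjOn (muFun H q) s := by
  intro x hx y hy hxy
  have hp := mul_left_cancel₀ (muFun_coeff_pos q).ne' hxy
  have ha : |H * Real.Gamma (2 * H) * x ^ (-2 * H) - 1|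
      = |H * Real.Gamma (2 * H) * y ^ (-2 * H) - 1| := by
    refine (pow_left_inj₀ (abs_nonneg _) (abs_nonneg _) hq).1 ?_
    rw [← abs_pow, ← abs_pow, hp]
  refine (strictAntiOn_muFun_base hH).injOn (hs hx) (hs hy) ?_
  rcases h with h | h
  · rwa [abs_of_nonneg (h x hx), abs_of_nonneg (h y hy)] at ha
  · rw [abs_of_nonpos (h x hx), abs_of_nonpos (h y hy)] at ha
    exact neg_injective ha

/-- The base of the power in `μ_q` vanishes at `θ* = (H Γ(2H)) ^ (1 / (2H))`. -/
lemma muFun_base_eq_zero (hH : 0 < H) :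
    H * Real.Gamma (2 * H) * ((H * Real.Gamma (2 * H)) ^ (1 / (2 * H))) ^ (-2 * H) - 1 = 0 := by
  have hG := mul_Gamma_two_mul_pos hH
  rw [← Real.rpow_mul hG.le, show 1 / (2 * H) * (-2 * H) = -1 by field_simp, Real.rpow_neg_one,
    mul_inv_cancel₀ hG.ne', sub_self]

lemma continuousOn_muFun (H : ℝ) (q : ℕ) : ContinuousOn (muFun H q) (Set.Ioi 0) := by
  unfold muFun
  refine continuousOn_const.mul (ContinuousOn.pow (ContinuousOn.sub (continuousOn_const.mul ?_)
    continuousOn_const) _)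
  exact continuousOn_id.rpow_const fun x hx ↦ Or.inl (ne_of_gt hx)

/-- The inverse of a continuous injective function on an open set of reals is continuous, in the
form needed for a sequence that need not stay in the image. -/
lemma eventually_mem_image_and_tendsto_invFunOn {ι : Type*} {l : Filter ι} {f : ℝ → ℝ} {I : Set ℝ}
    {θ : ℝ} (hI : IsOpen I) (hf : ContinuousOn f I) (hinj : Set.InjOn f I) (hθ : θ ∈ I)
    {y : ι → ℝ} (hy : Tendsto y l (𝓝 (f θ))) :
    (∀ᶠ n in l, y n ∈ f '' I) ∧ Tendsto (fun n ↦ Function.invFunOn f I (y n)) l (𝓝 θ) := by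
  have key : ∀ U ∈ 𝓝 θ, ∀ᶠ n in l, y n ∈ f '' (I ∩ U) := fun U hU ↦ by
    obtain ⟨ε, hε, hball⟩ := Metric.mem_nhds_iff.1 (inter_mem (hI.mem_nhds hθ) hU)
    have hsub : Set.Icc (θ - ε / 2) (θ + ε / 2) ⊆ I ∩ U := fun x hx ↦ by
      refine hball ?_
      rw [Metric.mem_ball, Real.dist_eq, abs_lt]
      constructor <;> linarith [hx.1, hx.2]
    have hle : θ - ε / 2 ≤ θ + ε / 2 := by linarith
    have hc : ContinuousOn f (Set.Icc (θ - ε / 2) (θ + ε / 2)) :=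
      hf.mono (hsub.trans Set.inter_subset_left)
    have hi : Set.InjOn f (Set.Icc (θ - ε / 2) (θ + ε / 2)) :=
      hinj.mono (hsub.trans Set.inter_subset_left)
    have m1 : θ - ε / 2 ∈ Set.Icc (θ - ε / 2) (θ + ε / 2) := Set.left_mem_Icc.2 hle
    have m2 : θ + ε / 2 ∈ Set.Icc (θ - ε / 2) (θ + ε / 2) := Set.right_mem_Icc.2 hle
    have m3 : θ ∈ Set.Icc (θ - ε / 2) (θ + ε / 2) := ⟨by linarith, by linarith⟩
    have himg : f '' Set.Icc (θ - ε / 2) (θ + ε / 2) ∈ 𝓝 (f θ) := by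
      rcases hc.strictMonoOn_of_injOn_Icc' hle hi with h | h
      · exact mem_of_superset (Icc_mem_nhds (h m1 m3 (by linarith)) (h m3 m2 (by linarith)))
          (intermediate_value_Icc hle hc)
      · exact mem_of_superset (Icc_mem_nhds (h m3 m2 (by linarith)) (h m1 m3 (by linarith)))
          (intermediate_value_Icc' hle hc)
    filter_upwards [hy himg] with n hn using Set.image_mono hsub hn
  refine ⟨?_, fun U hU ↦ ?_⟩
  · filter_upwards [key Set.univ univ_mem] with n hn using Set.image_mono Set.inter_subset_left hn
  · refine (key U hU).mono ?_
    rintro n ⟨x, hx, hxy⟩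
    change Function.invFunOn f I (y n) ∈ U
    rw [← hxy, hinj.leftInvOn_invFunOn hx.1]
    exact hx.2

end MuFun

/-! ### Convergence of the Hermite variations -/

section HermiteVariation

open Polynomial in
lemma exists_forall_neg_le_eval_realHermite {q : ℕ} (hq2 : q ≠ 0) (hq : Even q) :
    ∃ c, ∀ x, -c ≤ (realHermite q).eval x := by
  have hmon : (realHermite q).Monic := (hermite_monic q).map _
  have hdeg : (realHermite q).natDegree = q := by
    rw [(hermite_monic q).natDegree_map, natDegree_hermite]
  have htop : ∀ p : ℝ[X], p.natDegree = q → p.leadingCoeff = 1 →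
      Tendsto (fun x ↦ p.eval x) atTop atTop := fun p hp hl ↦
    p.tendsto_atTop_of_leadingCoeff_nonneg
      (natDegree_pos_iff_degree_pos.1 (by omega)) (by rw [hl]; exact zero_le_one)
  have h1 := htop _ hdeg hmon.leadingCoeff
  have h2 := htop ((realHermite q).comp (-X))
    (by rw [natDegree_comp, hdeg, natDegree_neg, natDegree_X, mul_one])
    (by
      rw [leadingCoeff_comp (by simp), hmon.leadingCoeff, hdeg, leadingCoeff_neg,
        leadingCoeff_X, one_mul, hq.neg_one_pow])
  have h3 : Tendsto (fun x ↦ (realHermite q).eval x) atBot atTop := by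
    refine (h2.comp tendsto_neg_atBot_atTop).congr fun x ↦ ?_
    simp
  have h4 : Tendsto (fun x ↦ (realHermite q).eval x) (cocompact ℝ) atTop := by
    rw [cocompact_eq_atBot_atTop]
    exact h3.sup h1
  obtain ⟨x₀, hx₀⟩ := (realHermite q).continuous.exists_forall_le h4
  exact ⟨-(realHermite q).eval x₀, fun x ↦ by rw [neg_neg]; exact hx₀ x⟩

variable {Ω : Type*} [MeasurableSpace Ω] {P : Measure Ω} {B X : ℝ≥0 → Ω → ℝ} {H θ : ℝ}

lemma exists_abs_ouCov_natCast_le (hθ : 0 < θ) (hH : H ∈ Set.Ioo (0 : ℝ) 1) :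
    ∃ C, 0 ≤ C ∧ ∀ j k : ℕ, j ≤ k →
      |ouCov H θ j k| ≤ C * ((k - j : ℕ) + 1 : ℝ) ^ (-min (2 - 2 * H) (1 / 2)) := by
  obtain ⟨C₁, h₁⟩ := abs_ouCov_le hθ hH
  obtain ⟨M, hM⟩ := (tendsto_ouCov_self hθ hH).abs.bddAbove_range
  have hM' : ∀ k : ℕ, |ouCov H θ k k| ≤ M := fun k ↦ hM ⟨k, rfl⟩
  have hM0 : 0 ≤ M := (abs_nonneg _).trans (hM' 0)
  refine ⟨4 * |C₁| + M, by positivity, fun j k hjk ↦ ?_⟩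
  rcases hjk.eq_or_lt with rfl | hlt
  · have := hM' j
    simp only [Nat.sub_self, Nat.cast_zero, zero_add, Real.one_rpow, mul_one]
    linarith [abs_nonneg C₁]
  · have h := h₁ j k (by exact_mod_cast hlt)
    set d : ℕ := k - j with hd
    have hd1 : (1 : ℝ) ≤ d := by exact_mod_cast (by omega : 1 ≤ d)
    have hcast : (((k : ℝ≥0) : ℝ) - ((j : ℝ≥0) : ℝ)) = d := by
      rw [hd, Nat.cast_sub hjk]; simp
    rw [hcast] at h
    have hr : (d : ℝ) ^ (2 * H - 2) ≤ 4 * ((d : ℝ) + 1) ^ (-min (2 - 2 * H) (1 / 2)) := by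
      calc (d : ℝ) ^ (2 * H - 2) ≤ (((d : ℝ) + 1) / 2) ^ (2 * H - 2) :=
            Real.rpow_le_rpow_of_nonpos (by positivity) (by linarith) (by linarith [hH.2])
        _ = 2 ^ (2 - 2 * H) * ((d : ℝ) + 1) ^ (2 * H - 2) := by
            rw [Real.div_rpow (by positivity) two_pos.le, div_eq_mul_inv,
              ← Real.rpow_neg two_pos.le, neg_sub, mul_comm]
        _ ≤ 4 * ((d : ℝ) + 1) ^ (-min (2 - 2 * H) (1 / 2)) := by
            refine mul_le_mul ?_ ?_ (by positivity) (by norm_num)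
            · calc (2 : ℝ) ^ (2 - 2 * H) ≤ 2 ^ (2 : ℝ) :=
                  Real.rpow_le_rpow_of_exponent_le (by norm_num) (by linarith [hH.1])
                _ = 4 := by norm_num
            · exact Real.rpow_le_rpow_of_exponent_le (by linarith)
                (by linarith [min_le_left (2 - 2 * H) (1 / 2)])
    have hpos : 0 ≤ ((d : ℝ) + 1) ^ (-min (2 - 2 * H) (1 / 2)) := by positivity
    calc |ouCov H θ j k| ≤ |C₁| * (d : ℝ) ^ (2 * H - 2) :=
          h.trans (mul_le_mul_of_nonneg_right (le_abs_self _) (by positivity))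
      _ ≤ |C₁| * (4 * ((d : ℝ) + 1) ^ (-min (2 - 2 * H) (1 / 2))) := by gcongr
      _ ≤ _ := by nlinarith [mul_nonneg hM0 hpos]

/-- Almost surely, the Hermite variations of even order converge to `μ_q(θ)`. -/
theorem ae_tendsto_hermiteVariation [IsProbabilityMeasure P] (hH : H ∈ Set.Ioo (0 : ℝ) 1)
    (hθ : 0 < θ) {q : ℕ} (hq0 : q ≠ 0) (hq : Even q) (hB : IsFractionalBrownianMotion H B P)
    (hX : IsOrnsteinUhlenbeckDrivenBy θ X B P) :
    ∀ᵐ ω ∂P, Tendsto (fun n : ℕ ↦ hermiteVariation q n (fun k ↦ X (k : ℝ≥0) ω)) atTop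
      (𝓝 (muFun H q θ)) := by
  have hpair := fun j k : ℕ ↦ gaussian_pair_ou hθ hH.1 hB hX (j : ℝ≥0) (k : ℝ≥0)
  have hvar : ∀ k : ℕ, Var[X k; P] = ouCov H θ k k := fun k ↦ by
    rw [← covariance_self (hpair k k).1.fst.aemeasurable, (hpair k k).2.2]
  obtain ⟨C, hC0, hC⟩ := exists_abs_ouCov_natCast_le hθ hH
  have hvC : ∀ k : ℕ, Var[X k; P] ≤ C := fun k ↦ by
    have := (le_abs_self _).trans (hC k k le_rfl)
    simpa [hvar k] using this
  obtain ⟨D, hD⟩ := exists_abs_covariance_polynomial_le P C (realHermite q) (realHermite q)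
  obtain ⟨c, hc⟩ := exists_forall_neg_le_eval_realHermite hq0 hq
  -- the rate `2 - 2 H` is capped below `1`, where the partial sums of `d ^ (-κ)` grow as `n ^ (1 - κ)`
  set κ := min (2 - 2 * H) (1 / 2) with hκ
  have hκ0 : 0 < κ := lt_min (by linarith [hH.2]) (by norm_num)
  have hκ1 : κ < 1 := (min_le_right _ _).trans_lt (by norm_num)
  obtain ⟨m, hm⟩ : ∃ m, q = 2 * m := ⟨q / 2, by have := Nat.div_two_mul_two_of_even hq; omega⟩
  have hmq : q / 2 = m := by omega
  have hmean : Tendsto (fun k : ℕ ↦ ∫ ω, (realHermite q).eval (X k ω) ∂P) atTop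
      (𝓝 (muFun H q θ)) := by
    have e : ∀ k : ℕ, ∫ ω, (realHermite q).eval (X k ω) ∂P
        = (q.factorial : ℝ) / ((m.factorial : ℝ) * 2 ^ m) * (ouCov H θ k k - 1) ^ m := fun k ↦ by
      rw [← hvar k, hm]
      exact integral_realHermite_two_mul (hpair k k).1.fst (hpair k k).2.1 m
    simp_rw [e]
    unfold muFun
    rw [hmq]
    exact (((tendsto_ouCov_self hθ hH).sub_const 1).pow m).const_mul _
  have key := ae_tendsto_sum_div_of_covariance_le (P := P)
    (Z := fun k ω ↦ (realHermite q).eval (X (k : ℝ≥0) ω)) hκ0 hκ1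
    (C := |D| * C) (by positivity)
    (fun k ↦ (hpair k k).1.fst.memLp_two_polynomial_eval _)
    (fun j k hjk ↦ by
      have h := hD (X j) (X k) (hpair j k).1 (hpair j k).2.1 (hpair k j).2.1 (hvC j) (hvC k)
      rw [(hpair j k).2.2] at h
      refine h.trans ?_
      rw [mul_assoc]
      exact mul_le_mul (le_abs_self D) (hC j k hjk) (abs_nonneg _) (abs_nonneg _))
    (fun k ω ↦ hc _) hmean
  filter_upwards [key] with ω hω
  refine hω.congr fun n ↦ ?_
  unfold hermiteVariation
  simp only [aeval_hermite_eq_eval]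
  ring

end HermiteVariation

/-! ### Strong consistency of the estimator -/

theorem mainTheorem7 {Ω : Type*} [MeasurableSpace Ω] (P : Measure Ω) [IsProbabilityMeasure P]
    (H θ : ℝ) (hH : H ∈ Set.Ioo (0 : ℝ) 1) (hθ : 0 < θ)
    (q : ℕ) (hq2 : 2 ≤ q) (hq : Even q)
    (B X : ℝ≥0 → Ω → ℝ) (hB : IsFractionalBrownianMotion H B P)
    (hX : IsOrnsteinUhlenbeckDrivenBy θ X B P) :
    (Odd (q / 2) → Set.InjOn (muFun H q) (Set.Ioi 0)) ∧
    (Even (q / 2) →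
      Set.InjOn (muFun H q) (Set.Ioo 0 ((H * Real.Gamma (2 * H)) ^ (1 / (2 * H)))) ∧
      Set.InjOn (muFun H q) (Set.Ioi ((H * Real.Gamma (2 * H)) ^ (1 / (2 * H))))) ∧
    ∀ I : Set ℝ, IsOpen I → I ⊆ Set.Ioi 0 → Set.InjOn (muFun H q) I → θ ∈ I →
      ∀ᵐ ω ∂P,
        (∀ᶠ n : ℕ in atTop,
          hermiteVariation q n (fun k ↦ X (k : ℝ≥0) ω) ∈ muFun H q '' I) ∧
        Tendsto (fun n : ℕ ↦ hermiteEstimator H q I n (fun k ↦ X (k : ℝ≥0) ω))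
          atTop (𝓝 θ) := by
  have hqm : q / 2 ≠ 0 := by omega
  have hanti := (strictAntiOn_muFun_base hH.1).antitoneOn
  have hstar : (0 : ℝ) < (H * Real.Gamma (2 * H)) ^ (1 / (2 * H)) :=
    Real.rpow_pos_of_pos (mul_Gamma_two_mul_pos hH.1) _
  have hzero := muFun_base_eq_zero hH.1
  refine ⟨injOn_muFun_of_odd hH.1, fun _ ↦ ⟨?_, ?_⟩, fun I hI hI0 hinj hθI ↦ ?_⟩
  · refine injOn_muFun_of_sign hH.1 hqm (fun x hx ↦ hx.1) (Or.inl fun x hx ↦ ?_)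
    exact hzero.symm.trans_le (hanti hx.1 hstar hx.2.le)
  · refine injOn_muFun_of_sign hH.1 hqm (fun x hx ↦ hstar.trans hx) (Or.inr fun x hx ↦ ?_)
    exact (hanti hstar (hstar.trans hx) (le_of_lt hx)).trans_eq hzero
  · filter_upwards [ae_tendsto_hermiteVariation hH hθ (by omega) hq hB hX] with ω hω
    exact eventually_mem_image_and_tendsto_invFunOn hI ((continuousOn_muFun H q).mono hI0) hinj
      hθI hω
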